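/- Let $(K,\Delta)$ be a metric space with $\Delta(x,y)\le 1$ for all $x,y\in K$. For $\epsilon>0$ let $N_\epsilon$ be its $\epsilon$-covering number (the least number of closed $\epsilon$-balls with centres in $K$ that cover $K$), and suppose that its upper Minkowski dimension $$d=\limsup_{\epsilon\to0}\frac{\log N_\epsilon}{\log(1/\epsilon)}$$ is finite and satisfies $d\ge 1$. Consider the $T$-round bandit game: losses $\ell_1,\dots,\ell_T:K\to[0,1]$, each $1$-Lipschitz with respect to $\Delta$, are fixed in advance; in round $t$ the learner picks a (randomized) action $i_t\in K$ and then observes only the number $\ell_t(i_t)$. The movement regret is $$\mathrm{Regret}_{\mathsf{MC}}(\ell_{1:T},\Delta)=\mathbb E\Big[\sum_{t=1}^T\ell_t(i_t)+\sum_{t=2}^T\Delta(i_t,i_{t-1})\Big]-\inf_{i\in K}\sum_{t=1}^T\ell_t(i).$$ Then there are randomized strategies $S_T$ ($T=1,2,\dots$; $S_T$ may use the horizon $T$ and the space $(K,\Delta)$) whose movement regret is of order $T^{\frac{d+1}{d+2}}$ in the following sense. 1. The regret is at most $T^{\frac{d+1}{d+2}+o(1)}$: for every $\delta>0$ there is a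 constant $C$ such that for every $T\ge1$ and all such losses $\ell_1,\dots,\ell_T$, the strategy $S_T$ has movement regret at most $C\,T^{\frac{d+1}{d+2}+\delta}$. 2. If $N_\epsilon=\widetilde O(\epsilon^{-d})$ as $\epsilon\to0$, that is, if there are $q\in\mathbb N$ and a constant $C_0$ with $N_\epsilon\le C_0\,(\log(1/\epsilon))^q\,\epsilon^{-d}$ for all sufficiently small $\epsilon>0$, then the regret is $\widetilde O\big(T^{\frac{d+1}{d+2}}\big)$: there are $p\in\mathbb N$ and a constant $C$ such that for every $T\ge1$ and all such losses $\ell_1,\dots,\ell_T$, the same strategy $S_T$ has movement regret at most $C\,(1+\log T)^p\,T^{\frac{d+1}{d+2}}$. -/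

import Mathlib

open Filter Topology
open scoped NNReal ENNReal

namespace MovementBandit

universe u

/-- The `ε`-covering number of the whole space: the least cardinality of a set of points of `K`
whose closed `ε`-balls cover `K` (it is `⊤` if no finite such set exists). -/
noncomputable def coveringNum (K : Type u) [MetricSpace K] (ε : ℝ≥0) : ℕ∞ :=
  Metric.coveringNumber ε (Set.univ : Set K)

/-- The upper Minkowski dimension `limsup_{ε → 0} log N_ε / log (1/ε)`, an extended real. -/
noncomputable def upperMinkowskiDim (K : Type u) [MetricSpace K] : EReal :=
  limsup (fun ε : ℝ≥0 =>
      ENNReal.log ((coveringNum K ε : ℕ∞) : ℝ≥0∞) / ((Real.log (1 / (ε : ℝ)) : ℝ) : EReal))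
    (𝓝[>] 0)

/-- A randomized bandit strategy with action set `K`. The learner keeps a private internal state
(for instance the history of the game together with the outcomes of her coin flips). In each round
she draws an action from a distribution that depends on the state, sees one real number, the loss
of that action, and draws her next state from a distribution that depends on the
state, the action and the observed loss. -/
structure Strategy (K : Type u) where
  /-- the internal states -/
  State : Type u
  /-- distribution of the state before the first round -/
  init : PMF State
  /-- distribution of the action, given the state -/
  choose : State → PMF K
  /-- distribution of the next state, given the state, the action and the observed loss -/
  update : State → K → ℝ → PMF State

/-- The joint law of the final internal state and of the actions `i_1, …, i_n`, when the strategy is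
played for `n` rounds against the losses `ℓ`. -/
noncomputable def Strategy.run {K : Type u} (S : Strategy K) :
    (n : ℕ) → (Fin n → K → ℝ) → PMF (S.State × (Fin n → K))
  | 0, _ => S.init.bind fun s => PMF.pure (s, Fin.elim0)
  | n + 1, ℓ =>
    (S.run n fun t => ℓ t.castSucc).bind fun (s, x) =>
      (S.choose s).bind fun i =>
        (S.update s i (ℓ (Fin.last n) i)).bind fun s' =>
          PMF.pure (s', Fin.snoc x i)

/-- The law of the sequence of actions. -/
noncomputable def Strategy.actionLaw {K : Type u} (S : Strategy K) {T : ℕ}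
    (ℓ : Fin T → K → ℝ) : PMF (Fin T → K) :=
  (S.run T ℓ).map Prod.snd

/-- The total cost of a sequence of actions: the losses plus the distances between consecutive
actions. -/
noncomputable def totalCost {K : Type u} [MetricSpace K] {T : ℕ} (ℓ : Fin T → K → ℝ)
    (x : Fin T → K) : ℝ :=
  (∑ t : Fin T, ℓ t (x t)) +
    ∑ t : Fin T, if h : (t : ℕ) + 1 < T then dist (x ⟨(t : ℕ) + 1, h⟩) (x t) else 0

/-- The movement regret: expected total cost minus the total loss of the best fixed action.
(For losses in `[0, 1]` and distances at most `1` the cost is bounded, so the sum that expresses the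
expectation converges.) -/
noncomputable def movementRegret {K : Type u} [MetricSpace K] (S : Strategy K) {T : ℕ}
    (ℓ : Fin T → K → ℝ) : ℝ :=
  (∑' x : Fin T → K, (S.actionLaw ℓ x).toReal * totalCost ℓ x) - ⨅ i : K, ∑ t : Fin T, ℓ t i

/-- Loss sequences with values in `[0, 1]` all of whose members are `1`-Lipschitz. -/
def IsLipschitzLoss {K : Type u} [MetricSpace K] {T : ℕ} (ℓ : Fin T → K → ℝ) : Prop :=
  ∀ t, LipschitzWith 1 (ℓ t) ∧ ∀ i, ℓ t i ∈ Set.Icc (0 : ℝ) 1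

/-- The strategy guarantees movement regret at most `B` over `T` rounds, whatever the
(`1`-Lipschitz, `[0, 1]`-valued) losses are. -/
def Guarantees {K : Type u} [MetricSpace K] (S : Strategy K) (T : ℕ) (B : ℝ) : Prop :=
  ∀ ℓ : Fin T → K → ℝ, IsLipschitzLoss ℓ → movementRegret S ℓ ≤ B

/-- `N_ε = Õ(ε^{-d})` as `ε → 0`: the covering numbers are at most `ε^{-d}` up to a constant and a
power of the logarithm of `1/ε`. -/
def CoveringNumIsPolylog (K : Type u) [MetricSpace K] (d : ℝ) : Prop :=
  ∃ (q : ℕ) (C : ℝ), ∀ᶠ ε : ℝ≥0 in 𝓝[>] 0,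
    ((coveringNum K ε : ℕ∞) : ℝ≥0∞) ≤
      ENNReal.ofReal (C * (Real.log (1 / (ε : ℝ))) ^ q * (1 / (ε : ℝ)) ^ d)

end MovementBandit

-- The learner runs exponential weights on the leaves of a tree of cells over a finite net, with
-- importance-weighted loss estimates. Between times `t` and `t + 1` the leaf is redrawn only inside
-- its current cell of level `v + 1`, where `v = padicValNat 2 (t + 1)`, so large moves are rare:
-- valuation at least `h` occurs at most `T / 2 ^ h` times.
--
-- The regret is bounded first along each path (`sum_loss_le`). In an aligned block of length `2 ^
-- h` play stays in one cell of level `h`, whose nominal mass is frozen. Mass times the log-decrease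
-- of the cell's weight passes from level `h` to `h + 1` through two-sided bounds on `-log (1 - q (1
-- - exp (-y)))`, with `q` the share of the child in its parent. On leaves this quantity is `η`
-- times the observed loss; at the root it telescopes to the logarithm of the total weight. The
-- second-order error at level `h` is of order `η ^ 2 * 2 ^ h / mass`.
--
-- The masses need not be marginal probabilities. What matters is that the inverse mass of the
-- played cell, restricted to a fixed cell, has mean at most one (`expect_invMass_le_one`). This
-- controls the estimated loss of the comparator, and makes the variance of level `h` at most `2 ^
-- h` times the number of cells.
--
-- Finally the scales `T ^ (-1 / (d + 2)) * 2 ^ (h / d)` make `2 ^ h * ε ^ (-d)` the same at every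
-- level, with `O(log T)` levels up to diameter one. Since `d ≥ 1`, the scale grows no faster than
-- `2 ^ h`, so the rarity of moves pays for their length (`exists_strategy`).

namespace MovementBandit

/-! ### Trees of cells, weights and nominal masses -/

/-- A nested sequence of partitions of `ι` into cells: the cells of level `0` are singletons, and
from the level `depth` on there is only one cell. -/
structure CellTree (ι κ : Type*) where
  /-- the name of the cell of level `h` that contains a point -/
  cell : ℕ → ι → κ
  /-- a level from which on there is only one cell -/
  depth : ℕ
  cell_zero_injective : Function.Injective (cell 0)
  cell_succ : ∀ h i j, cell h i = cell h j → cell (h + 1) i = cell (h + 1) j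
  cell_top : ∀ h, depth ≤ h → ∀ i j, cell h i = cell h j

namespace CellTree

variable {ι κ : Type*} (A : CellTree ι κ)

lemma cell_mono {h h' : ℕ} (hh : h ≤ h') {i j : ι} (e : A.cell h i = A.cell h j) :
    A.cell h' i = A.cell h' j := by
  induction hh with
  | refl => exact e
  | step _ ih => exact A.cell_succ _ _ _ ih

variable [Fintype ι]

open Classical in
/-- The total weight of the cell of level `h` that contains `i`. -/
noncomputable def cellWeight (w : ι → ℝ) (h : ℕ) (i : ι) : ℝ :=
  ∑ j with A.cell h j = A.cell h i, w j

variable {A} in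
lemma cellWeight_pos {w : ι → ℝ} (hw : ∀ i, 0 < w i) (h : ℕ) (i : ι) :
    0 < A.cellWeight w h i :=
  Finset.sum_pos (fun j _ => hw j) ⟨i, by simp⟩

variable {A} in
lemma cellWeight_congr {w : ι → ℝ} {h : ℕ} {i j : ι} (e : A.cell h i = A.cell h j) :
    A.cellWeight w h i = A.cellWeight w h j := by
  exact Finset.sum_congr (by ext; simp [e]) fun _ _ => rfl

lemma cellWeight_zero (w : ι → ℝ) (i : ι) : A.cellWeight w 0 i = w i := by
  classical
  have : (Finset.univ.filter fun j => A.cell 0 j = A.cell 0 i) = {i} := by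
    ext j; simp [A.cell_zero_injective.eq_iff]
  simp [cellWeight, this]

lemma cellWeight_top (w : ι → ℝ) {h : ℕ} (hh : A.depth ≤ h) (i : ι) :
    A.cellWeight w h i = ∑ j, w j := by
  classical
  simp [cellWeight, A.cell_top h hh _ i]

/-- If two weights agree outside a cell, then the weights of the parent cell differ as much as the
weights of the cell. -/
lemma cellWeight_succ_sub {w w' : ι → ℝ} {h : ℕ} {i : ι}
    (hw : ∀ j, A.cell h j ≠ A.cell h i → w' j = w j) :
    A.cellWeight w (h + 1) i - A.cellWeight w' (h + 1) i =
      A.cellWeight w h i - A.cellWeight w' h i := by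
  classical
  simp only [cellWeight, ← Finset.sum_sub_distrib]
  symm
  apply Finset.sum_subset
  · intro j
    simpa using A.cell_succ h j i
  · intro j _ hj
    simp only [Finset.mem_filter, Finset.mem_univ, true_and] at hj
    rw [hw j hj, sub_self]

open Classical in
/-- The weights of the leaves and the nominal masses of the cells at time `t`, when the leaves `x`
were chosen and the losses `r` were observed. -/
noncomputable def dynamics (η : ℝ) (x : ℕ → ι) (r : ℕ → ℝ) : ℕ → (ι → ℝ) × (ℕ → ι → ℝ)
  | 0 => (fun _ => 1, fun h i => A.cellWeight (fun _ => 1) h i / Fintype.card ι)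
  | t + 1 =>
    let p := dynamics η x r t
    let w : ι → ℝ := fun j =>
      if j = x t then p.1 j * Real.exp (-(η * (r t / p.2 0 j))) else p.1 j
    let v := padicValNat 2 (t + 1)
    -- The mass at level `v + 1` is kept, and below it is redistributed in proportion to the new
    -- weights: the same rule by which the leaf is redrawn.
    (w, fun h i => if h ≤ v then p.2 (v + 1) i * (A.cellWeight w h i / A.cellWeight w (v + 1) i)
      else p.2 h i)

/-- The weights of the leaves. -/
noncomputable def weight (η : ℝ) (x : ℕ → ι) (r : ℕ → ℝ) (t : ℕ) : ι → ℝ :=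
  (A.dynamics η x r t).1

/-- The nominal mass of the cell of level `h` that contains a leaf. -/
noncomputable def mass (η : ℝ) (x : ℕ → ι) (r : ℕ → ℝ) (t : ℕ) : ℕ → ι → ℝ :=
  (A.dynamics η x r t).2

variable (η : ℝ) (x : ℕ → ι) (r : ℕ → ℝ)

lemma weight_zero : A.weight η x r 0 = fun _ => 1 := rfl

lemma mass_zero (h : ℕ) (i : ι) :
    A.mass η x r 0 h i = A.cellWeight (fun _ => 1) h i / Fintype.card ι := rfl

open Classical in
lemma weight_succ (t : ℕ) (j : ι) : A.weight η x r (t + 1) j =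
    if j = x t then A.weight η x r t j * Real.exp (-(η * (r t / A.mass η x r t 0 j)))
    else A.weight η x r t j := rfl

lemma mass_succ_of_le {t h : ℕ} (hh : h ≤ padicValNat 2 (t + 1)) (i : ι) :
    A.mass η x r (t + 1) h i = A.mass η x r t (padicValNat 2 (t + 1) + 1) i *
      (A.cellWeight (A.weight η x r (t + 1)) h i /
        A.cellWeight (A.weight η x r (t + 1)) (padicValNat 2 (t + 1) + 1) i) :=
  if_pos hh

lemma mass_succ_of_lt {t h : ℕ} (hh : padicValNat 2 (t + 1) < h) (i : ι) :
    A.mass η x r (t + 1) h i = A.mass η x r t h i :=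
  if_neg (not_le.2 hh)

/-- Non-anticipation: it makes the dynamics computable from the history, and insensitive to later
draws. -/
lemma dynamics_congr {x' : ℕ → ι} {r' : ℕ → ℝ} {t : ℕ} (hx : ∀ s < t, x s = x' s)
    (hr : ∀ s < t, r s = r' s) : A.dynamics η x r t = A.dynamics η x' r' t := by
  induction t with
  | zero => rfl
  | succ t ih =>
    have := ih (fun s hs => hx s (by omega)) (fun s hs => hr s (by omega))
    have hxt := hx t (by omega)
    simp only [dynamics, this, hr t (by omega)]
    generalize x t = a at hxt
    subst hxt
    rfl

lemma weight_pos (t : ℕ) (j : ι) : 0 < A.weight η x r t j := by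
  induction t with
  | zero => simp [weight_zero]
  | succ t ih =>
    rw [weight_succ]
    split_ifs
    · positivity
    · exact ih

lemma mass_pos (t h : ℕ) (i : ι) : 0 < A.mass η x r t h i := by
  induction t generalizing h with
  | zero =>
    rw [mass_zero]
    have : Nonempty ι := ⟨i⟩
    exact div_pos (cellWeight_pos (fun _ => one_pos) h i) (by exact_mod_cast Fintype.card_pos)
  | succ t ih =>
    rcases le_or_gt h (padicValNat 2 (t + 1)) with hh | hh
    · rw [A.mass_succ_of_le η x r hh]
      exact mul_pos (ih _) (div_pos (cellWeight_pos (A.weight_pos η x r _) _ _)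
        (cellWeight_pos (A.weight_pos η x r _) _ _))
    · rw [A.mass_succ_of_lt η x r hh]
      exact ih h

lemma mass_congr (t : ℕ) {h : ℕ} {i j : ι} (e : A.cell h i = A.cell h j) :
    A.mass η x r t h i = A.mass η x r t h j := by
  induction t generalizing h with
  | zero => rw [mass_zero, mass_zero, cellWeight_congr e]
  | succ t ih =>
    rcases le_or_gt h (padicValNat 2 (t + 1)) with hh | hh
    · have e' := A.cell_mono (hh.trans (Nat.le_succ _)) e
      rw [A.mass_succ_of_le η x r hh, A.mass_succ_of_le η x r hh, cellWeight_congr e,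
        cellWeight_congr e', ih e']
    · rw [A.mass_succ_of_lt η x r hh, A.mass_succ_of_lt η x r hh, ih e]

lemma mass_top (t : ℕ) {h : ℕ} (hh : A.depth ≤ h) (i : ι) : A.mass η x r t h i = 1 := by
  induction t generalizing h with
  | zero =>
    have : Nonempty ι := ⟨i⟩
    rw [mass_zero, A.cellWeight_top _ hh]
    simp
  | succ t ih =>
    rcases le_or_gt h (padicValNat 2 (t + 1)) with h1 | h1
    · rw [A.mass_succ_of_le η x r h1, ih (by omega), A.cellWeight_top _ hh,
        A.cellWeight_top _ (by omega), one_mul, div_self]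
      exact (Finset.sum_pos (fun j _ => A.weight_pos η x r _ j) ⟨i, by simp⟩).ne'
    · rw [A.mass_succ_of_lt η x r h1, ih hh]

/-- At a multiple of `2 ^ h` the conditional distribution of the cell of level `h` in its parent is
the one given by the current weights. -/
lemma mass_eq_mass_succ_mul {t h : ℕ} (ht : 2 ^ h ∣ t) (i : ι) :
    A.mass η x r t h i = A.mass η x r t (h + 1) i *
      (A.cellWeight (A.weight η x r t) h i / A.cellWeight (A.weight η x r t) (h + 1) i) := by
  have hW := fun h => (cellWeight_pos (A := A) (A.weight_pos η x r t) h i).ne'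
  cases t with
  | zero =>
    rw [weight_zero] at hW ⊢
    rw [mass_zero, mass_zero]
    have := hW (h + 1)
    field_simp
  | succ t =>
    have hh : h ≤ padicValNat 2 (t + 1) := (padicValNat_dvd_iff_le (by omega)).1 ht
    rw [A.mass_succ_of_le η x r hh]
    -- If `h` is below the valuation, parent and child are both refreshed from the same ancestor; if
    -- it equals the valuation, the parent is that ancestor and keeps its mass.
    rcases hh.lt_or_eq with h1 | h1
    · rw [A.mass_succ_of_le η x r (h := h + 1) h1]
      have := hW (h + 1)
      field_simp
    · rw [A.mass_succ_of_lt η x r (h := h + 1) (by omega), ← h1]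

end CellTree
end MovementBandit

namespace MovementBandit

/-! ### Regret along a single path -/

lemma neg_log_one_sub_le {q y : ℝ} (hq : 0 < q) (hq1 : q ≤ 1) :
    -Real.log (1 - q * (1 - Real.exp (-y))) ≤ q * y := by
  have hpos : 0 < 1 - q * (1 - Real.exp (-y)) := by
    have := mul_pos hq (Real.exp_pos (-y))
    nlinarith
  rw [neg_le, Real.le_log_iff_exp_le hpos]
  -- Jensen for `exp` at the points `-y` and `0` with weights `q` and `1 - q`.
  have := convexOn_exp.2 (Set.mem_univ (-y)) (Set.mem_univ 0) hq.le (sub_nonneg.2 hq1) (by ring)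
  simp only [smul_eq_mul, mul_zero, add_zero, Real.exp_zero, mul_one] at this
  calc Real.exp (-(q * y)) = Real.exp (q * -y) := by ring_nf
    _ ≤ _ := this
    _ = _ := by ring

lemma exp_neg_le_quadratic {y : ℝ} (hy : 0 ≤ y) : Real.exp (-y) ≤ 1 - y + y ^ 2 / 2 := by
  have h := Real.quadratic_le_exp_of_nonneg hy
  have h1 : Real.exp (-y) * Real.exp y = 1 := by rw [← Real.exp_add]; simp
  have h2 : 0 < 1 + y + y ^ 2 / 2 := by positivity
  have h3 : Real.exp (-y) * (1 + y + y ^ 2 / 2) ≤ 1 := by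
    exact (mul_le_mul_of_nonneg_left h (Real.exp_pos _).le).trans h1.le
  have h4 : Real.exp (-y) ≤ 1 / (1 + y + y ^ 2 / 2) := by rwa [le_div_iff₀ h2]
  refine h4.trans ?_
  rw [div_le_iff₀ h2]
  -- `(1 - y + y ^ 2 / 2) * (1 + y + y ^ 2 / 2) = 1 + y ^ 4 / 4`.
  nlinarith [sq_nonneg (y ^ 2)]

lemma le_neg_log_one_sub {q y : ℝ} (hq : 0 < q) (hq1 : q ≤ 1) (hy : 0 ≤ y) :
    q * (y - y ^ 2 / 2) ≤ -Real.log (1 - q * (1 - Real.exp (-y))) := by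
  have hpos : 0 < 1 - q * (1 - Real.exp (-y)) := by
    have := mul_pos hq (Real.exp_pos (-y))
    nlinarith
  have h1 := Real.log_le_sub_one_of_pos hpos
  have h2 := mul_le_mul_of_nonneg_left (exp_neg_le_quadratic hy) hq.le
  linarith

namespace CellTree

variable {ι κ : Type*} (A : CellTree ι κ) {η : ℝ} {x : ℕ → ι} {r : ℕ → ℝ}

/-- Consecutive leaves lie in a common cell of the lowest level that does not change its mass. -/
def IsPath (x : ℕ → ι) : Prop :=
  ∀ t, A.cell (padicValNat 2 (t + 1) + 1) (x (t + 1)) =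
    A.cell (padicValNat 2 (t + 1) + 1) (x t)

/-- Multiples of `2 ^ h` are at least `2 ^ h` apart, so strictly inside an aligned block every
redraw stays within a cell of level at most `h`. Both the frozen cell and the frozen mass rest on
this. -/
lemma padicValNat_lt_of_mem_block {h s t : ℕ} (hs : 2 ^ h ∣ s) (h1 : s ≤ t)
    (h2 : t + 1 < s + 2 ^ h) : padicValNat 2 (t + 1) < h := by
  by_contra hc
  have hd : 2 ^ h ∣ t + 1 := (padicValNat_dvd_iff_le (by omega)).2 (not_lt.1 hc)
  have hd' := (Nat.dvd_sub hd hs)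
  have := Nat.le_of_dvd (by omega) hd'
  omega

variable {A}

lemma IsPath.cell_eq (hx : A.IsPath x) {h s t : ℕ} (hs : 2 ^ h ∣ s) (h1 : s ≤ t)
    (h2 : t < s + 2 ^ h) : A.cell h (x t) = A.cell h (x s) := by
  induction t, h1 using Nat.le_induction with
  | base => rfl
  | succ t h1 ih =>
    rw [← ih (by omega)]
    exact A.cell_mono (padicValNat_lt_of_mem_block hs h1 h2) (hx t)

variable (A) [Fintype ι]

lemma mass_eq_of_mem_block {h s t : ℕ} (hs : 2 ^ h ∣ s) (h1 : s ≤ t)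
    (h2 : t < s + 2 ^ h) (i : ι) : A.mass η x r t h i = A.mass η x r s h i := by
  induction t, h1 using Nat.le_induction with
  | base => rfl
  | succ t h1 ih =>
    rw [← ih (by omega), mass_succ_of_lt]
    exact padicValNat_lt_of_mem_block hs h1 h2

lemma weight_eq_of_forall_ne {s t : ℕ} (h1 : s ≤ t) {j : ι} (hj : ∀ u, s ≤ u → u < t → x u ≠ j) :
    A.weight η x r t j = A.weight η x r s j := by
  induction t, h1 using Nat.le_induction with
  | base => rfl
  | succ t h1 ih =>
    rw [← ih fun u h h' => hj u h (by omega), weight_succ, if_neg]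
    exact (hj t h1 (by omega)).symm

variable (η x r) in
/-- The negative logarithm of the factor by which the weight of the current cell of level `h`
changes in the block of length `2 ^ h` that starts at time `s`. -/
noncomputable def logDecrease (h s : ℕ) : ℝ :=
  -Real.log (A.cellWeight (A.weight η x r (s + 2 ^ h)) h (x s) /
    A.cellWeight (A.weight η x r s) h (x s))

variable {A}

lemma exp_neg_logDecrease (h s : ℕ) : Real.exp (-A.logDecrease η x r h s) =
    A.cellWeight (A.weight η x r (s + 2 ^ h)) h (x s) /
      A.cellWeight (A.weight η x r s) h (x s) := by
  rw [logDecrease, neg_neg, Real.exp_log]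
  exact div_pos (cellWeight_pos (A.weight_pos η x r _) _ _)
    (cellWeight_pos (A.weight_pos η x r _) _ _)

lemma cellWeight_le_succ {w : ι → ℝ} (hw : ∀ i, 0 < w i) (h : ℕ) (i : ι) :
    A.cellWeight w h i ≤ A.cellWeight w (h + 1) i := by
  classical
  apply Finset.sum_le_sum_of_subset_of_nonneg
  · intro j
    simpa using A.cell_succ h j i
  · intro j _ _
    exact (hw j).le

variable (A) in
lemma weight_succ_le (hη : 0 ≤ η) (hr : ∀ t, 0 ≤ r t) (t : ℕ) (j : ι) :
    A.weight η x r (t + 1) j ≤ A.weight η x r t j := by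
  rw [weight_succ]
  split_ifs with hj
  · have h1 := (A.weight_pos η x r t j).le
    have h2 : 0 ≤ η * (r t / A.mass η x r t 0 j) :=
      mul_nonneg hη (div_nonneg (hr t) (A.mass_pos η x r t 0 j).le)
    exact mul_le_of_le_one_right h1 (Real.exp_le_one_iff.2 (by linarith))
  · exact le_rfl

lemma logDecrease_nonneg (hη : 0 ≤ η) (hr : ∀ t, 0 ≤ r t) (h s : ℕ) :
    0 ≤ A.logDecrease η x r h s := by
  have hW := fun t => cellWeight_pos (A := A) (A.weight_pos η x r t) h (x s)
  rw [logDecrease, neg_nonneg]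
  apply Real.log_nonpos (div_nonneg (hW _).le (hW _).le)
  rw [div_le_one (hW _)]
  refine Finset.sum_le_sum fun j _ => ?_
  exact antitone_nat_of_succ_le (f := fun t => A.weight η x r t j)
    (fun t => A.weight_succ_le hη hr t j) (Nat.le_add_right _ _)

/-- Base of the induction on levels: the importance weight of the estimate cancels against the mass
of the leaf. -/
lemma logDecrease_zero (s : ℕ) :
    A.mass η x r s 0 (x s) * A.logDecrease η x r 0 s = η * r s := by
  rw [logDecrease, pow_zero, cellWeight_zero, cellWeight_zero, weight_succ, if_pos rfl,
    mul_div_cancel_left₀ _ (A.weight_pos η x r s _).ne', Real.log_exp, neg_neg]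
  have := (A.mass_pos η x r s 0 (x s)).ne'
  field_simp

/-- The decrease of the weight of the parent cell in a block. -/
lemma cellWeight_succ_div (hx : A.IsPath x) {h u : ℕ} (hu : 2 ^ h ∣ u) :
    A.cellWeight (A.weight η x r (u + 2 ^ h)) (h + 1) (x u) /
        A.cellWeight (A.weight η x r u) (h + 1) (x u) =
      1 - A.cellWeight (A.weight η x r u) h (x u) / A.cellWeight (A.weight η x r u) (h + 1) (x u) *
        (1 - Real.exp (-A.logDecrease η x r h u)) := by
  have h0 := (cellWeight_pos (A := A) (A.weight_pos η x r u) h (x u)).ne'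
  have h1 := (cellWeight_pos (A := A) (A.weight_pos η x r u) (h + 1) (x u)).ne'
  -- During the block only leaves of the current cell are played, so the parent loses exactly the
  -- weight that the child loses.
  have key := A.cellWeight_succ_sub (w := A.weight η x r u) (w' := A.weight η x r (u + 2 ^ h))
    (h := h) (i := x u) fun j hj => A.weight_eq_of_forall_ne (Nat.le_add_right _ _)
      fun t ht ht' e => hj (by rw [← e, hx.cell_eq hu ht ht'])
  rw [exp_neg_logDecrease]
  field_simp
  linarith

/-- The logarithm telescopes over the two halves of the block. The child cell may differ between the
halves, but the parent does not. -/
lemma logDecrease_succ (hx : A.IsPath x) {h s : ℕ} (hs : 2 ^ (h + 1) ∣ s) :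
    A.logDecrease η x r (h + 1) s =
      -Real.log (A.cellWeight (A.weight η x r (s + 2 ^ h)) (h + 1) (x s) /
        A.cellWeight (A.weight η x r s) (h + 1) (x s)) +
      -Real.log (A.cellWeight (A.weight η x r (s + 2 ^ h + 2 ^ h)) (h + 1) (x (s + 2 ^ h)) /
        A.cellWeight (A.weight η x r (s + 2 ^ h)) (h + 1) (x (s + 2 ^ h))) := by
  have hW := fun t => (cellWeight_pos (A := A) (A.weight_pos η x r t) (h + 1) (x s)).ne'
  have hp : 0 < 2 ^ h := by positivity
  have e := hx.cell_eq hs (t := s + 2 ^ h) (by omega) (by rw [pow_succ]; omega)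
  rw [cellWeight_congr e, cellWeight_congr e, logDecrease, Real.log_div (hW _) (hW _),
    Real.log_div (hW _) (hW _), Real.log_div (hW _) (hW _),
    show s + 2 ^ (h + 1) = s + 2 ^ h + 2 ^ h by ring]
  ring

/-- At the aligned time `u` the child's share `q` of the parent's weight is also its share of the
parent's mass, so the factor `q` in `neg_log_one_sub_le` turns the parent's mass into the child's.
-/
lemma mass_mul_neg_log_le (hx : A.IsPath x) {h u : ℕ} (hu : 2 ^ h ∣ u) :
    A.mass η x r u (h + 1) (x u) *
      -Real.log (A.cellWeight (A.weight η x r (u + 2 ^ h)) (h + 1) (x u) /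
        A.cellWeight (A.weight η x r u) (h + 1) (x u)) ≤
      A.mass η x r u h (x u) * A.logDecrease η x r h u := by
  rw [cellWeight_succ_div hx hu, A.mass_eq_mass_succ_mul η x r hu, mul_assoc]
  have h0 := cellWeight_pos (A := A) (A.weight_pos η x r u) h (x u)
  have h1 := cellWeight_pos (A := A) (A.weight_pos η x r u) (h + 1) (x u)
  have h2 := cellWeight_le_succ (A := A) (A.weight_pos η x r u) h (x u)
  exact mul_le_mul_of_nonneg_left (neg_log_one_sub_le (div_pos h0 h1) ((div_le_one h1).2 h2))
    (A.mass_pos η x r u _ _).le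

lemma le_mass_mul_neg_log (hη : 0 ≤ η) (hr : ∀ t, 0 ≤ r t) (hx : A.IsPath x) {h u : ℕ}
    (hu : 2 ^ h ∣ u) :
    A.mass η x r u h (x u) * (A.logDecrease η x r h u - A.logDecrease η x r h u ^ 2 / 2) ≤
    A.mass η x r u (h + 1) (x u) *
      -Real.log (A.cellWeight (A.weight η x r (u + 2 ^ h)) (h + 1) (x u) /
        A.cellWeight (A.weight η x r u) (h + 1) (x u)) := by
  rw [cellWeight_succ_div hx hu, A.mass_eq_mass_succ_mul η x r hu, mul_assoc]
  have h0 := cellWeight_pos (A := A) (A.weight_pos η x r u) h (x u)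
  have h1 := cellWeight_pos (A := A) (A.weight_pos η x r u) (h + 1) (x u)
  have h2 := cellWeight_le_succ (A := A) (A.weight_pos η x r u) h (x u)
  exact mul_le_mul_of_nonneg_left (le_neg_log_one_sub (div_pos h0 h1) ((div_le_one h1).2 h2)
    (logDecrease_nonneg hη hr _ _)) (A.mass_pos η x r u _ _).le

lemma sum_Ico_block (f : ℕ → ℝ) (h s : ℕ) : ∑ t ∈ Finset.Ico s (s + 2 ^ (h + 1)), f t =
    ∑ t ∈ Finset.Ico s (s + 2 ^ h), f t +
      ∑ t ∈ Finset.Ico (s + 2 ^ h) (s + 2 ^ h + 2 ^ h), f t := by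
  rw [Finset.sum_Ico_consecutive f (Nat.le_add_right _ _) (Nat.le_add_right _ _), pow_succ,
    mul_two, add_assoc]

lemma mass_half (hx : A.IsPath x) {h s : ℕ} (hs : 2 ^ (h + 1) ∣ s) :
    A.mass η x r s (h + 1) (x s) = A.mass η x r (s + 2 ^ h) (h + 1) (x (s + 2 ^ h)) := by
  have hp : 0 < 2 ^ h := by positivity
  rw [A.mass_eq_of_mem_block hs (t := s + 2 ^ h) (by omega) (by rw [pow_succ]; omega)]
  apply A.mass_congr
  exact (hx.cell_eq hs (t := s + 2 ^ h) (by omega) (by rw [pow_succ]; omega)).symm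

/-- This upper bound serves only to control the quadratic error in the matching lower bound
`le_mass_mul_logDecrease`. -/
lemma mass_mul_logDecrease_le (hx : A.IsPath x) (h : ℕ) : ∀ s, 2 ^ h ∣ s →
    A.mass η x r s h (x s) * A.logDecrease η x r h s ≤
      η * ∑ t ∈ Finset.Ico s (s + 2 ^ h), r t := by
  induction h with
  | zero => intro s _; rw [logDecrease_zero]; simp
  | succ h ih =>
    intro s hs
    have h1 : 2 ^ h ∣ s := (pow_dvd_pow 2 h.le_succ).trans hs
    have h2 : 2 ^ h ∣ s + 2 ^ h := h1.add dvd_rfl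
    rw [logDecrease_succ hx hs, mul_add, sum_Ico_block, mul_add]
    refine add_le_add ((mass_mul_neg_log_le hx h1).trans (ih s h1)) ?_
    rw [mass_half hx hs]
    exact (mass_mul_neg_log_le hx h2).trans (ih _ h2)

variable (A η x r) in
/-- The variance term of round `t`, over the levels below `h`. -/
noncomputable def varianceTerm (h t : ℕ) : ℝ :=
  ∑ j ∈ Finset.range h, 2 ^ j * r t / A.mass η x r t j (x t)

/-- With mass `Q`, log-decrease `y` and block loss `R`: `Q * y ^ 2 = (Q * y) ^ 2 / Q ≤ (η * R) ^ 2 /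
Q`, and one factor `R` is bounded by the block length. The result is linear in the losses, hence a
sum over rounds. -/
lemma mass_mul_sq_le (hη : 0 ≤ η) (hr : ∀ t, r t ∈ Set.Icc (0 : ℝ) 1) (hx : A.IsPath x) {h u : ℕ}
    (hu : 2 ^ h ∣ u) : A.mass η x r u h (x u) * A.logDecrease η x r h u ^ 2 ≤
      η ^ 2 * ∑ t ∈ Finset.Ico u (u + 2 ^ h), 2 ^ h * r t / A.mass η x r t h (x t) := by
  have hQ := A.mass_pos η x r u h (x u)
  have h1 := mass_mul_logDecrease_le (r := r) (η := η) hx h u hu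
  have h0 : 0 ≤ A.mass η x r u h (x u) * A.logDecrease η x r h u :=
    mul_nonneg hQ.le (logDecrease_nonneg hη (fun t => (hr t).1) _ _)
  set R := ∑ t ∈ Finset.Ico u (u + 2 ^ h), r t with hR
  have hR0 : 0 ≤ R := Finset.sum_nonneg fun t _ => (hr t).1
  have hR1 : R ≤ 2 ^ h := by
    refine (Finset.sum_le_sum fun t _ => (hr t).2).trans ?_
    simp
  have e : ∑ t ∈ Finset.Ico u (u + 2 ^ h), 2 ^ h * r t / A.mass η x r t h (x t) =
      2 ^ h * R / A.mass η x r u h (x u) := by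
    rw [hR, Finset.mul_sum, Finset.sum_div]
    refine Finset.sum_congr rfl fun t ht => ?_
    rw [Finset.mem_Ico] at ht
    rw [A.mass_eq_of_mem_block hu ht.1 ht.2, A.mass_congr _ _ _ _ (hx.cell_eq hu ht.1 ht.2)]
  rw [e, ← mul_div_assoc, le_div_iff₀ hQ]
  calc _ = (A.mass η x r u h (x u) * A.logDecrease η x r h u) ^ 2 := by ring
    _ ≤ (η * R) ^ 2 := pow_le_pow_left₀ h0 h1 2
    _ = η ^ 2 * (R * R) := by ring
    _ ≤ η ^ 2 * (2 ^ h * R) := by gcongr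

/-- Induction on levels: each half block loses one quadratic term, which is exactly the new summand
`j = h` of the variance. -/
lemma le_mass_mul_logDecrease (hη : 0 ≤ η) (hr : ∀ t, r t ∈ Set.Icc (0 : ℝ) 1)
    (hx : A.IsPath x) (h : ℕ) : ∀ s, 2 ^ h ∣ s →
    η * ∑ t ∈ Finset.Ico s (s + 2 ^ h), r t -
      η ^ 2 / 2 * ∑ t ∈ Finset.Ico s (s + 2 ^ h), A.varianceTerm η x r h t ≤
    A.mass η x r s h (x s) * A.logDecrease η x r h s := by
  induction h with
  | zero => intro s _; rw [logDecrease_zero]; simp [varianceTerm]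
  | succ h ih =>
    intro s hs
    have h1 : 2 ^ h ∣ s := (pow_dvd_pow 2 h.le_succ).trans hs
    have h2 : 2 ^ h ∣ s + 2 ^ h := h1.add dvd_rfl
    have step : ∀ u, 2 ^ h ∣ u → η * ∑ t ∈ Finset.Ico u (u + 2 ^ h), r t -
        η ^ 2 / 2 * ∑ t ∈ Finset.Ico u (u + 2 ^ h), A.varianceTerm η x r (h + 1) t ≤
        A.mass η x r u (h + 1) (x u) *
      -Real.log (A.cellWeight (A.weight η x r (u + 2 ^ h)) (h + 1) (x u) /
        A.cellWeight (A.weight η x r u) (h + 1) (x u)) := by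
      intro u hu
      refine le_trans ?_ (le_mass_mul_neg_log hη (fun t => (hr t).1) hx hu)
      have ha := ih u hu
      have hb := mass_mul_sq_le hη hr hx hu
      simp only [varianceTerm, Finset.sum_range_succ, Finset.sum_add_distrib] at ha ⊢
      linarith
    rw [logDecrease_succ hx hs, mul_add, sum_Ico_block, sum_Ico_block]
    have s1 := step s h1
    have s2 := step _ h2
    rw [← mass_half hx hs] at s2
    linarith

lemma sum_logDecrease_depth [Nonempty ι] (m : ℕ) :
    ∑ k ∈ Finset.range m, A.logDecrease η x r A.depth (k * 2 ^ A.depth) =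
      Real.log (Fintype.card ι) - Real.log (∑ j, A.weight η x r (m * 2 ^ A.depth) j) := by
  have hW : ∀ t, (∑ j, A.weight η x r t j) ≠ 0 := fun t =>
    (Finset.sum_pos (fun j _ => A.weight_pos η x r t j) Finset.univ_nonempty).ne'
  induction m with
  | zero => simp [weight_zero]
  | succ m ih =>
    rw [Finset.sum_range_succ, ih, logDecrease, A.cellWeight_top _ le_rfl,
      A.cellWeight_top _ le_rfl, Real.log_div (hW _) (hW _),
      show (m + 1) * 2 ^ A.depth = m * 2 ^ A.depth + 2 ^ A.depth by ring]
    ring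

open Classical in
lemma log_weight (t : ℕ) (i : ι) : Real.log (A.weight η x r t i) =
    -(η * ∑ s ∈ Finset.range t, if x s = i then r s / A.mass η x r s 0 (x s) else 0) := by
  induction t with
  | zero => simp [weight_zero]
  | succ t ih =>
    rw [weight_succ, Finset.sum_range_succ]
    by_cases e : x t = i
    · subst e
      rw [if_pos rfl, if_pos rfl, Real.log_mul (A.weight_pos η x r t _).ne' (Real.exp_pos _).ne',
        Real.log_exp, ih]
      ring
    · rw [if_neg (Ne.symm e), if_neg e, ih, add_zero]

lemma sum_range_blocks (f : ℕ → ℝ) (n m : ℕ) : ∑ t ∈ Finset.range (m * n), f t =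
    ∑ k ∈ Finset.range m, ∑ t ∈ Finset.Ico (k * n) (k * n + n), f t := by
  induction m with
  | zero => simp
  | succ m ih =>
    rw [Finset.sum_range_succ, ← ih, add_mul, one_mul, Finset.sum_range_add_sum_Ico]
    omega

open Classical in
/-- The regret bound for a single path. -/
theorem sum_loss_le [Nonempty ι] (hη : 0 < η) (hr : ∀ t, r t ∈ Set.Icc (0 : ℝ) 1)
    (hx : A.IsPath x) {n : ℕ} (hn : ∀ t, n ≤ t → r t = 0) (i : ι) :
    ∑ t ∈ Finset.range n, r t ≤
      (∑ t ∈ Finset.range n, if x t = i then r t / A.mass η x r t 0 (x t) else 0) +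
      Real.log (Fintype.card ι) / η +
      η / 2 * ∑ t ∈ Finset.range n, A.varianceTerm η x r A.depth t := by
  -- The horizon is rounded up to whole root blocks; the added rounds have zero loss and change no
  -- sum.
  set N := n * 2 ^ A.depth
  have hN : n ≤ N := Nat.le_mul_of_pos_right _ (by positivity)
  have ext : ∀ f : ℕ → ℝ, (∀ t, n ≤ t → f t = 0) →
      ∑ t ∈ Finset.range n, f t = ∑ t ∈ Finset.range N, f t := fun f hf =>
    Finset.sum_subset (Finset.range_subset_range.2 hN) fun t _ ht => hf t (by simpa using ht)
  have hv : ∀ t, n ≤ t → A.varianceTerm η x r A.depth t = 0 := fun t ht => by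
    simp [varianceTerm, hn t ht]
  rw [ext r hn, ext _ hv, ext (fun t => if x t = i then r t / A.mass η x r t 0 (x t) else 0)
    fun t ht => by simp [hn t ht]]
  have key : η * ∑ t ∈ Finset.range N, r t -
      η ^ 2 / 2 * ∑ t ∈ Finset.range N, A.varianceTerm η x r A.depth t ≤
      Real.log (Fintype.card ι) - Real.log (∑ j, A.weight η x r N j) := by
    rw [← sum_logDecrease_depth, sum_range_blocks, sum_range_blocks, Finset.mul_sum,
      Finset.mul_sum, ← Finset.sum_sub_distrib]
    refine Finset.sum_le_sum fun k _ => ?_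
    refine (le_mass_mul_logDecrease hη.le hr hx A.depth _ (dvd_mul_left _ _)).trans ?_
    rw [A.mass_top _ _ _ _ le_rfl, one_mul]
  -- The comparator enters as one summand of the total weight; its log-weight is `-η` times its
  -- estimated loss.
  have hW : Real.log (A.weight η x r N i) ≤ Real.log (∑ j, A.weight η x r N j) :=
    Real.log_le_log (A.weight_pos η x r N i)
      (Finset.single_le_sum (fun j _ => (A.weight_pos η x r N j).le) (Finset.mem_univ i))
  rw [log_weight] at hW
  rw [← mul_le_mul_iff_right₀ hη, mul_add, mul_add, mul_div_cancel₀ _ hη.ne']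
  linarith

end CellTree
end MovementBandit

namespace MovementBandit

/-! ### Expectations under a `PMF`, and the law of play -/

section Expect

variable {α β : Type*}

/-- The expectation of a nonnegative function. -/
noncomputable def expect (p : PMF α) (f : α → ℝ≥0∞) : ℝ≥0∞ := ∑' a, p a * f a

lemma expect_pure (a : α) (f : α → ℝ≥0∞) : expect (PMF.pure a) f = f a := by
  classical
  rw [expect, tsum_eq_single a fun b hb => by simp [hb]]
  simp

lemma expect_bind (p : PMF α) (q : α → PMF β) (f : β → ℝ≥0∞) :
    expect (p.bind q) f = expect p fun a => expect (q a) f := by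
  simp only [expect, PMF.bind_apply, ← ENNReal.tsum_mul_right, ← ENNReal.tsum_mul_left]
  rw [ENNReal.tsum_comm]
  simp only [mul_assoc]

lemma expect_map (p : PMF α) (g : α → β) (f : β → ℝ≥0∞) :
    expect (p.map g) f = expect p fun a => f (g a) := by
  rw [PMF.map, expect_bind]
  simp only [Function.comp, expect_pure]

lemma expect_mono {p : PMF α} {f g : α → ℝ≥0∞} (h : ∀ a ∈ p.support, f a ≤ g a) :
    expect p f ≤ expect p g := by
  refine ENNReal.tsum_le_tsum fun a => ?_
  by_cases ha : p a = 0
  · simp [ha]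
  · exact mul_le_mul_right (h a ((PMF.mem_support_iff _ _).2 ha)) _

lemma expect_congr {p : PMF α} {f g : α → ℝ≥0∞} (h : ∀ a ∈ p.support, f a = g a) :
    expect p f = expect p g :=
  le_antisymm (expect_mono fun a ha => (h a ha).le) (expect_mono fun a ha => (h a ha).ge)

lemma expect_add (p : PMF α) (f g : α → ℝ≥0∞) :
    expect p (fun a => f a + g a) = expect p f + expect p g := by
  simp only [expect, mul_add, ENNReal.tsum_add]

lemma expect_const_mul (p : PMF α) (c : ℝ≥0∞) (f : α → ℝ≥0∞) :
    expect p (fun a => c * f a) = c * expect p f := by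
  simp only [expect, ← ENNReal.tsum_mul_left, mul_left_comm]

lemma expect_const (p : PMF α) (c : ℝ≥0∞) : expect p (fun _ => c) = c := by
  simp [expect, ENNReal.tsum_mul_right]

end Expect

namespace CellTree

universe u
variable {ι : Type u} {κ : Type*} (A : CellTree ι κ) [Fintype ι]

section CellLaw

open Classical in
lemma sum_cellLaw {w : ι → ℝ} (hw : ∀ i, 0 < w i) (h : ℕ) (i : ι) :
    ∑ j, (if A.cell h j = A.cell h i then w j / A.cellWeight w h i else 0) = 1 := by
  rw [← Finset.sum_filter, ← Finset.sum_div]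
  exact div_self (cellWeight_pos hw h i).ne'

open Classical in
/-- The law of a leaf of a given cell, chosen with probability proportional to its weight. -/
noncomputable def cellLaw (w : ι → ℝ) (hw : ∀ i, 0 < w i) (h : ℕ) (i : ι) : PMF ι :=
  PMF.ofFintype
    (fun j => ENNReal.ofReal (if A.cell h j = A.cell h i then w j / A.cellWeight w h i else 0)) (by
      rw [← ENNReal.ofReal_sum_of_nonneg, A.sum_cellLaw hw, ENNReal.ofReal_one]
      intro j _
      split_ifs
      exacts [(div_pos (hw j) (cellWeight_pos hw h i)).le, le_rfl])

open Classical in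
lemma expect_cellLaw {w : ι → ℝ} (hw : ∀ i, 0 < w i) (h : ℕ) (i : ι) {f : ι → ℝ}
    (hf : ∀ j, 0 ≤ f j) :
    expect (A.cellLaw w hw h i) (fun j => ENNReal.ofReal (f j)) = ENNReal.ofReal
      (∑ j, (if A.cell h j = A.cell h i then w j / A.cellWeight w h i else 0) * f j) := by
  have h0 : ∀ j, 0 ≤ if A.cell h j = A.cell h i then w j / A.cellWeight w h i else 0 := by
    intro j
    split_ifs
    exacts [(div_pos (hw j) (cellWeight_pos hw h i)).le, le_rfl]
  rw [ENNReal.ofReal_sum_of_nonneg fun j _ => mul_nonneg (h0 j) (hf j), expect, tsum_fintype]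
  exact Finset.sum_congr rfl fun j _ => by rw [ENNReal.ofReal_mul (h0 j)]; rfl

lemma cell_eq_of_mem_support_cellLaw {w : ι → ℝ} (hw : ∀ i, 0 < w i) {h : ℕ} {i j : ι}
    (hj : j ∈ (A.cellLaw w hw h i).support) : A.cell h j = A.cell h i := by
  classical
  by_contra hc
  rw [PMF.mem_support_iff] at hj
  exact hj (by simp [cellLaw, hc])

end CellLaw

variable (η : ℝ)

open Classical in
/-- The inverse nominal mass of the cell of level `h` of the leaf of round `t` if this is the
cell `c`. -/
noncomputable def invMass (t h : ℕ) (c : κ) (x : ℕ → ι) (r : ℕ → ℝ) : ℝ :=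
  if A.cell h (x t) = c then (A.mass η x r t h (x t))⁻¹ else 0

lemma invMass_congr {t h : ℕ} {c : κ} {x x' : ℕ → ι} {r r' : ℕ → ℝ} (hx : ∀ s ≤ t, x s = x' s)
    (hr : ∀ s < t, r s = r' s) : A.invMass η t h c x r = A.invMass η t h c x' r' := by
  rw [invMass, invMass, hx t le_rfl, mass, mass,
    A.dynamics_congr η x r (fun s hs => hx s hs.le) hr]

open Classical in
/-- Averaging over the leaf of the next round, the inverse mass of a cell becomes the inverse mass
of its ancestor in the current round. -/
lemma sum_cellLaw_mul_inv_mass (x : ℕ → ι) (r : ℕ → ℝ) (n h : ℕ) (i : ι) :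
    ∑ j, (if A.cell (padicValNat 2 (n + 1) + 1) j = A.cell (padicValNat 2 (n + 1) + 1) (x n) then
        A.weight η x r (n + 1) j /
          A.cellWeight (A.weight η x r (n + 1)) (padicValNat 2 (n + 1) + 1) (x n) else 0) *
        (if A.cell h j = A.cell h i then (A.mass η x r (n + 1) h j)⁻¹ else 0) =
      A.invMass η n (max h (padicValNat 2 (n + 1) + 1))
        (A.cell (max h (padicValNat 2 (n + 1) + 1)) i) x r := by
  set v := padicValNat 2 (n + 1) with hv
  set w := A.weight η x r (n + 1) with hwdef
  have hw : ∀ j, 0 < w j := A.weight_pos η x r (n + 1)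
  have hW := fun h i => (cellWeight_pos (A := A) hw h i).ne'
  have hM := fun h i => (A.mass_pos η x r n h i).ne'
  -- For `h ≤ v` the cell is redrawn: its probability cancels the refreshed factor of its mass,
  -- leaving the inverse mass of the ancestor of level `v + 1`. Otherwise neither the cell nor its
  -- mass changes.
  rcases le_or_gt h v with hh | hh
  · rw [max_eq_right (by omega), invMass]
    split_ifs with hc
    · have e : ∀ j, (if A.cell (v + 1) j = A.cell (v + 1) (x n) then
          w j / A.cellWeight w (v + 1) (x n) else 0) *
          (if A.cell h j = A.cell h i then (A.mass η x r (n + 1) h j)⁻¹ else 0) =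
          (if A.cell h j = A.cell h i then w j else 0) *
            ((A.mass η x r n (v + 1) (x n))⁻¹ * (A.cellWeight w h i)⁻¹) := by
        intro j
        by_cases hj : A.cell h j = A.cell h i
        · have hj' := (A.cell_mono (show h ≤ v + 1 by omega) hj).trans hc.symm
          rw [if_pos hj, if_pos hj', if_pos hj, A.mass_succ_of_le η x r hh, ← hv, ← hwdef,
            cellWeight_congr hj, cellWeight_congr hj', A.mass_congr η x r n hj']
          have h1 := hW (v + 1) (x n)
          have h2 := hW h i
          have h3 := hM (v + 1) (x n)
          field_simp
        · simp [hj]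
      rw [Finset.sum_congr rfl fun j _ => e j, ← Finset.sum_mul, ← Finset.sum_filter]
      change A.cellWeight w h i * _ = _
      have h2 := hW h i
      field_simp
    · refine Finset.sum_eq_zero fun j _ => ?_
      by_cases hj : A.cell h j = A.cell h i
      · have hj' := A.cell_mono (show h ≤ v + 1 by omega) hj
        rw [if_neg (fun h' => hc (h'.symm.trans hj')), zero_mul]
      · rw [if_neg hj, mul_zero]
  · rw [max_eq_left (by omega), invMass]
    have e : ∀ j, (if A.cell (v + 1) j = A.cell (v + 1) (x n) then
        w j / A.cellWeight w (v + 1) (x n) else 0) *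
        (if A.cell h j = A.cell h i then (A.mass η x r (n + 1) h j)⁻¹ else 0) =
        (if A.cell (v + 1) j = A.cell (v + 1) (x n) then
        w j / A.cellWeight w (v + 1) (x n) else 0) *
        (if A.cell h (x n) = A.cell h i then (A.mass η x r n h (x n))⁻¹ else 0) := by
      intro j
      by_cases hj : A.cell (v + 1) j = A.cell (v + 1) (x n)
      · have hj' := A.cell_mono (show v + 1 ≤ h by omega) hj
        rw [hj', A.mass_succ_of_lt η x r hh, A.mass_congr η x r n hj']
      · rw [if_neg hj, zero_mul, zero_mul]
    rw [Finset.sum_congr rfl fun j _ => e j, ← Finset.sum_mul, A.sum_cellLaw hw, one_mul]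

variable [Nonempty ι] {K : Type u} (emb : ι → K)

/-- Exponential weights on the leaves of a tree of cells: between rounds `t` and `t + 1` the leaf
is drawn again, inside its cell of level `padicValNat 2 (t + 1) + 1`. The state consists of the
number of rounds played, the leaves and the observed losses. -/
noncomputable def strategy : Strategy K where
  State := ℕ × (ℕ → ι) × (ℕ → ℝ)
  init := (PMF.uniformOfFintype ι).map fun i => (0, fun _ => i, fun _ => 0)
  choose s := PMF.pure (emb (s.2.1 s.1))
  update s _ ρ :=
    (A.cellLaw (A.weight η s.2.1 (Function.update s.2.2 s.1 ρ) (s.1 + 1)) (A.weight_pos _ _ _ _)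
        (padicValNat 2 (s.1 + 1) + 1) (s.2.1 s.1)).map fun j =>
      -- The new leaf fills all future times and unplayed losses stay `0`, so every state carries a
      -- full infinite path to which `sum_loss_le` applies.
      (s.1 + 1, fun t => if t ≤ s.1 then s.2.1 t else j, Function.update s.2.2 s.1 ρ)

variable (ℓ : ℕ → K → ℝ)

/-- The joint law of the state and the actions after `n` rounds. -/
noncomputable def law (n : ℕ) : PMF ((ℕ × (ℕ → ι) × (ℕ → ℝ)) × (Fin n → K)) :=
  (A.strategy η emb).run n fun t => ℓ t

lemma law_zero : A.law η emb ℓ 0 =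
    (PMF.uniformOfFintype ι).map fun i => ((0, fun _ => i, fun _ => 0), Fin.elim0) := by
  exact PMF.bind_map _ _ _

lemma law_succ (n : ℕ) : A.law η emb ℓ (n + 1) = (A.law η emb ℓ n).bind fun z =>
    (A.cellLaw (A.weight η z.1.2.1 (Function.update z.1.2.2 z.1.1 (ℓ n (emb (z.1.2.1 z.1.1))))
      (z.1.1 + 1)) (A.weight_pos _ _ _ _) (padicValNat 2 (z.1.1 + 1) + 1) (z.1.2.1 z.1.1)).map
      fun j => ((z.1.1 + 1, fun t => if t ≤ z.1.1 then z.1.2.1 t else j,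
        Function.update z.1.2.2 z.1.1 (ℓ n (emb (z.1.2.1 z.1.1)))),
        Fin.snoc z.2 (emb (z.1.2.1 z.1.1))) := by
  change (A.law η emb ℓ n).bind _ = _
  congr 1
  funext z
  obtain ⟨s, y⟩ := z
  exact (PMF.pure_bind _ _).trans (PMF.bind_map _ _ _)

/-- What holds of the state and the actions after `n` rounds. -/
structure IsHistory (n : ℕ) (z : (ℕ × (ℕ → ι) × (ℕ → ℝ)) × (Fin n → K)) : Prop where
  round : z.1.1 = n
  path : A.IsPath z.1.2.1
  const : ∀ t, n ≤ t → z.1.2.1 t = z.1.2.1 n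
  action : ∀ t : Fin n, z.2 t = emb (z.1.2.1 t)
  loss : ∀ t < n, z.1.2.2 t = ℓ t (emb (z.1.2.1 t))
  loss_eq_zero : ∀ t, n ≤ t → z.1.2.2 t = 0

lemma isHistory_of_mem_support (n : ℕ) : ∀ z ∈ (A.law η emb ℓ n).support,
    A.IsHistory emb ℓ n z := by
  induction n with
  | zero =>
    intro z hz
    rw [law_zero, PMF.mem_support_map_iff] at hz
    obtain ⟨i, -, rfl⟩ := hz
    exact ⟨rfl, fun _ => rfl, fun _ _ => rfl, fun t => t.elim0, fun t ht => absurd ht (by omega),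
      fun _ _ => rfl⟩
  | succ n ih =>
    intro z hz
    rw [law_succ, PMF.mem_support_bind_iff] at hz
    obtain ⟨y, hy, hz⟩ := hz
    rw [PMF.mem_support_map_iff] at hz
    obtain ⟨j, hj, rfl⟩ := hz
    have hc := A.cell_eq_of_mem_support_cellLaw _ hj
    obtain ⟨⟨m, x, r⟩, a⟩ := y
    obtain ⟨h1, h2, h3, h4, h5, h6⟩ := ih _ hy
    dsimp only at h1 h2 h3 h4 h5 h6 hc ⊢
    subst h1
    refine ⟨rfl, fun t => ?_, fun t ht => ?_, fun t => ?_, fun t ht => ?_, fun t ht => ?_⟩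
      <;> dsimp only
    · rcases lt_trichotomy t m with h | h | h
      · rw [if_pos (by omega), if_pos (by omega)]
        exact h2 t
      · subst h
        rw [if_neg (by omega), if_pos le_rfl]
        exact hc
      · rw [if_neg (by omega), if_neg (by omega)]
    · rw [if_neg (by omega), if_neg (by omega)]
    · refine Fin.lastCases ?_ (fun t => ?_) t
      · simp
      · rw [Fin.snoc_castSucc, h4, Fin.val_castSucc, if_pos t.2.le]
    · rw [if_pos (by omega)]
      rcases (Nat.lt_succ_iff.1 ht).lt_or_eq with h | rfl
      · rw [Function.update_of_ne h.ne, h5 t h]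
      · rw [Function.update_self]
    · rw [Function.update_of_ne (by omega), h6 t (by omega)]

/-- The inverse mass of time `t` reads leaves up to `t` and losses before `t` only; playing on does
not touch it. -/
lemma expect_law_succ_of_le {n t : ℕ} (ht : t ≤ n) (h : ℕ) (c : κ) :
    expect (A.law η emb ℓ (n + 1)) (fun z => ENNReal.ofReal (A.invMass η t h c z.1.2.1 z.1.2.2)) =
    expect (A.law η emb ℓ n) (fun z => ENNReal.ofReal (A.invMass η t h c z.1.2.1 z.1.2.2)) := by
  rw [law_succ, expect_bind]
  refine expect_congr fun z hz => ?_
  have hr := (A.isHistory_of_mem_support η emb ℓ n z hz).round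
  rw [expect_map]
  refine (expect_congr (g := fun _ => ENNReal.ofReal (A.invMass η t h c z.1.2.1 z.1.2.2))
    fun j _ => congrArg _ (A.invMass_congr η ?_ ?_)).trans (expect_const _ _)
  · intro s hs
    exact if_pos (by omega)
  · intro s hs
    exact Function.update_of_ne (by omega) _ _

/-- For a nonempty cell the mean is one at time `0`, by uniformity. Averaging over the last draw
turns the quantity for level `h` into the one for level `max h (v + 1)` a round earlier, hence the
induction over all levels at once. -/
lemma expect_invMass_self_le_one (n h : ℕ) (c : κ) :
    expect (A.law η emb ℓ n)
      (fun z => ENNReal.ofReal (A.invMass η n h c z.1.2.1 z.1.2.2)) ≤ 1 := by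
  classical
  by_cases hc : ∃ i, A.cell h i = c
  swap
  · have : ∀ x r, A.invMass η n h c x r = 0 := fun x r => if_neg fun e => hc ⟨_, e⟩
    simp [this, expect_const]
  obtain ⟨i, rfl⟩ := hc
  induction n generalizing h i with
  | zero =>
    rw [law_zero, expect_map, expect, tsum_fintype]
    have hk : (0 : ℝ) < Fintype.card ι := by exact_mod_cast Fintype.card_pos
    have : ∀ j, (PMF.uniformOfFintype ι) j * ENNReal.ofReal (A.invMass η 0 h (A.cell h i)
        (fun _ => j) (fun _ => 0)) = ENNReal.ofReal (if A.cell h j = A.cell h i then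
          (A.cellWeight (fun _ => 1) h i)⁻¹ else 0) := by
      intro j
      rw [PMF.uniformOfFintype_apply, invMass, ← ENNReal.ofReal_natCast,
        ← ENNReal.ofReal_inv_of_pos hk, ← ENNReal.ofReal_mul (by positivity)]
      split_ifs with hj
      · rw [mass_zero, cellWeight_congr hj]
        congr 1
        field_simp
      · rw [mul_zero]
    simp only [this]
    have hW := cellWeight_pos (A := A) (w := fun _ => 1) (fun _ => one_pos) h i
    rw [← ENNReal.ofReal_sum_of_nonneg (fun j _ => by split_ifs <;> positivity),
      ← Finset.sum_filter, Finset.sum_const, nsmul_eq_mul]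
    have : A.cellWeight (fun _ => 1) h i =
      (Finset.univ.filter fun j => A.cell h j = A.cell h i).card := by simp [cellWeight]
    rw [← this, mul_inv_cancel₀ hW.ne', ENNReal.ofReal_one]
  | succ n ih =>
    refine le_trans (le_of_eq ?_) (ih (max h (padicValNat 2 (n + 1) + 1)) i)
    rw [law_succ, expect_bind]
    refine expect_congr fun z hz => ?_
    have hr := (A.isHistory_of_mem_support η emb ℓ n z hz).round
    obtain ⟨⟨m, x, r⟩, a⟩ := z
    dsimp only at hr ⊢
    subst hr
    rw [expect_map]
    dsimp only
    set r' := Function.update r m (ℓ m (emb (x m)))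
    rw [A.invMass_congr η (x' := x) (r := r) (r' := r') (fun _ _ => rfl) fun s hs =>
      (Function.update_of_ne (by omega) _ _).symm, ← A.sum_cellLaw_mul_inv_mass η x r' m h i,
      ← A.expect_cellLaw]
    · congr 1
      funext j
      have e : A.mass η (fun t => if t ≤ m then x t else j) r' (m + 1) =
          A.mass η x r' (m + 1) := by
        rw [mass, mass, A.dynamics_congr η _ r' (fun s hs => if_pos (by omega)) fun _ _ => rfl]
      rw [invMass, e, if_neg (show ¬ m + 1 ≤ m by omega)]
    · exact A.weight_pos η x r' (m + 1)
    · intro j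
      split_ifs
      exacts [(inv_pos.2 (A.mass_pos η _ _ _ h _)).le, le_rfl]

lemma expect_invMass_le_one {n t : ℕ} (ht : t ≤ n) (h : ℕ) (c : κ) :
    expect (A.law η emb ℓ n)
      (fun z => ENNReal.ofReal (A.invMass η t h c z.1.2.1 z.1.2.2)) ≤ 1 := by
  induction n, ht using Nat.le_induction with
  | base => exact A.expect_invMass_self_le_one η emb ℓ t h c
  | succ n hn ih => rwa [A.expect_law_succ_of_le η emb ℓ hn]

end CellTree
end MovementBandit

namespace MovementBandit

/-! ### Expected regret of the tree strategy -/

section ExpectLE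

variable {α β : Type*}

/-- The expectation of (the positive part of) `f` is at most `b`. -/
def ExpectLE (p : PMF α) (f : α → ℝ) (b : ℝ) : Prop :=
  0 ≤ b ∧ expect p (fun a => ENNReal.ofReal (f a)) ≤ ENNReal.ofReal b

lemma expectLE_const (p : PMF α) {b : ℝ} (hb : 0 ≤ b) : ExpectLE p (fun _ => b) b :=
  ⟨hb, (expect_const p _).le⟩

lemma ExpectLE.add {p : PMF α} {f g : α → ℝ} {b c : ℝ} (hf : ExpectLE p f b)
    (hg : ExpectLE p g c) : ExpectLE p (fun a => f a + g a) (b + c) := by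
  refine ⟨add_nonneg hf.1 hg.1, ?_⟩
  rw [ENNReal.ofReal_add hf.1 hg.1]
  refine (expect_mono fun a _ => ENNReal.ofReal_add_le).trans ?_
  rw [expect_add]
  exact add_le_add hf.2 hg.2

lemma ExpectLE.const_mul {p : PMF α} {f : α → ℝ} {b c : ℝ} (hc : 0 ≤ c) (hf : ExpectLE p f b) :
    ExpectLE p (fun a => c * f a) (c * b) := by
  refine ⟨mul_nonneg hc hf.1, ?_⟩
  simp only [ENNReal.ofReal_mul hc]
  rw [expect_const_mul]
  exact mul_le_mul_right hf.2 _

lemma ExpectLE.sum {p : PMF α} (s : Finset β) {f : β → α → ℝ} {b : β → ℝ}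
    (h : ∀ i ∈ s, ExpectLE p (f i) (b i)) : ExpectLE p (fun a => ∑ i ∈ s, f i a) (∑ i ∈ s, b i) := by
  classical
  induction s using Finset.induction_on with
  | empty => simpa using expectLE_const p le_rfl
  | insert i s hi ih =>
    simp only [Finset.sum_insert hi]
    exact (h i (Finset.mem_insert_self _ _)).add
      (ih fun j hj => h j (Finset.mem_insert_of_mem hj))

lemma ExpectLE.mono {p : PMF α} {f g : α → ℝ} {b : ℝ} (hf : ExpectLE p f b)
    (h : ∀ a ∈ p.support, g a ≤ f a) : ExpectLE p g b :=
  ⟨hf.1, (expect_mono fun a ha => ENNReal.ofReal_le_ofReal (h a ha)).trans hf.2⟩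

lemma ExpectLE.map {p : PMF α} {g : α → β} {f : β → ℝ} {b : ℝ}
    (hf : ExpectLE p (fun a => f (g a)) b) : ExpectLE (p.map g) f b :=
  ⟨hf.1, (expect_map p g _).trans_le hf.2⟩

lemma ExpectLE.tsum_le {p : PMF α} {f : α → ℝ} {b : ℝ} (hf : ExpectLE p f b)
    (h0 : ∀ a, 0 ≤ f a) : ∑' a, (p a).toReal * f a ≤ b := by
  have : ∀ a, (p a).toReal * f a = (p a * ENNReal.ofReal (f a)).toReal := fun a => by
    rw [ENNReal.toReal_mul, ENNReal.toReal_ofReal (h0 a)]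
  simp only [this]
  rw [← ENNReal.tsum_toReal_eq fun a =>
    ENNReal.mul_ne_top (PMF.apply_ne_top _ _) ENNReal.ofReal_ne_top]
  exact ENNReal.toReal_le_of_le_ofReal hf.1 hf.2

end ExpectLE

namespace CellTree

universe u
variable {ι : Type u} {κ : Type*} (A : CellTree ι κ) [Fintype ι]

open Classical in
/-- The number of cells of level `h`. -/
noncomputable def numCells (h : ℕ) : ℕ := (Finset.univ.image (A.cell h)).card

variable {K : Type u} (emb : ι → K)

open Classical in
-- Each cell contributes mean at most one, so the mean inverse mass of the played cell is at most
-- the number of cells.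
lemma sum_invMass {η : ℝ} (t h : ℕ) (x : ℕ → ι) (r : ℕ → ℝ) :
    ∑ c ∈ Finset.univ.image (A.cell h), A.invMass η t h c x r = (A.mass η x r t h (x t))⁻¹ := by
  simp only [invMass]
  rw [Finset.sum_ite_eq, if_pos (Finset.mem_image_of_mem _ (Finset.mem_univ _))]

variable [Nonempty ι] [MetricSpace K]

open Classical in
lemma totalCost_le {η : ℝ} (hη : 0 < η) {D : ℕ → ℝ}
    (hD : ∀ h i j, A.cell h i = A.cell h j → dist (emb i) (emb j) ≤ D h) {T : ℕ}
    {ℓ : ℕ → K → ℝ} (hℓ : ∀ t i, ℓ t i ∈ Set.Icc (0 : ℝ) 1)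
    {z : (ℕ × (ℕ → ι) × (ℕ → ℝ)) × (Fin T → K)} (hz : A.IsHistory emb ℓ T z) (i : ι) :
    totalCost (fun t : Fin T => ℓ t) z.2 ≤
      (∑ t ∈ Finset.range T, ℓ t (emb i) * A.invMass η t 0 (A.cell 0 i) z.1.2.1 z.1.2.2) +
      Real.log (Fintype.card ι) / η +
      η / 2 * ∑ t ∈ Finset.range T, ∑ j ∈ Finset.range A.depth, 2 ^ j *
        ∑ c ∈ Finset.univ.image (A.cell j), A.invMass η t j c z.1.2.1 z.1.2.2 +
      ∑ t ∈ Finset.range T, D (padicValNat 2 (t + 1) + 1) := by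
  obtain ⟨⟨m, x, r⟩, y⟩ := z
  obtain ⟨-, h2, -, h4, h5, h6⟩ := hz
  dsimp only at h2 h4 h5 h6 ⊢
  have hr : ∀ t, r t ∈ Set.Icc (0 : ℝ) 1 := by
    intro t
    rcases lt_or_ge t T with h | h
    · rw [h5 t h]; exact hℓ _ _
    · rw [h6 t h]; simp
  have key := A.sum_loss_le hη hr h2 h6 i
  have e1 : ∑ t : Fin T, ℓ t (y t) = ∑ t ∈ Finset.range T, r t := by
    rw [← Fin.sum_univ_eq_sum_range]
    exact Finset.sum_congr rfl fun t _ => by rw [h4, h5 t t.2]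
  have e2 : ∀ t ∈ Finset.range T, (if x t = i then r t / A.mass η x r t 0 (x t) else 0) =
      ℓ t (emb i) * A.invMass η t 0 (A.cell 0 i) x r := by
    intro t ht
    rw [invMass, A.cell_zero_injective.eq_iff]
    split_ifs with h
    · rw [h5 t (Finset.mem_range.1 ht), h, div_eq_mul_inv]
    · rw [mul_zero]
  have e3 : ∑ t ∈ Finset.range T, A.varianceTerm η x r A.depth t ≤
      ∑ t ∈ Finset.range T, ∑ j ∈ Finset.range A.depth, 2 ^ j *
        ∑ c ∈ Finset.univ.image (A.cell j), A.invMass η t j c x r := by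
    refine Finset.sum_le_sum fun t _ => Finset.sum_le_sum fun j _ => ?_
    rw [sum_invMass, ← div_eq_mul_inv]
    have := A.mass_pos η x r t j (x t)
    gcongr
    exact mul_le_of_le_one_right (by positivity) (hr t).2
  have e4 : (∑ t : Fin T, if h : (t : ℕ) + 1 < T then dist (y ⟨(t : ℕ) + 1, h⟩) (y t) else 0) ≤
      ∑ t ∈ Finset.range T, D (padicValNat 2 (t + 1) + 1) := by
    rw [← Fin.sum_univ_eq_sum_range fun t => D (padicValNat 2 (t + 1) + 1)]
    refine Finset.sum_le_sum fun t _ => ?_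
    split_ifs with h
    · rw [h4, h4]
      exact hD _ _ _ (h2 t)
    · exact dist_nonneg.trans (hD _ i i rfl)
  rw [Finset.sum_congr rfl e2] at key
  have e5 := mul_le_mul_of_nonneg_left e3 (show 0 ≤ η / 2 by positivity)
  rw [totalCost, e1]
  linarith

/-- The regret bound of the strategy of a tree of cells. -/
theorem guarantees_strategy {η : ℝ} (hη : 0 < η) {D : ℕ → ℝ}
    (hD : ∀ h i j, A.cell h i = A.cell h j → dist (emb i) (emb j) ≤ D h) {ρ : ℝ}
    (hρ : ∀ y, ∃ i, dist (emb i) y ≤ ρ) (T : ℕ) :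
    Guarantees (A.strategy η emb) T (T * ρ + Real.log (Fintype.card ι) / η +
      η / 2 * (T * ∑ j ∈ Finset.range A.depth, 2 ^ j * (A.numCells j : ℝ)) +
      ∑ t ∈ Finset.range T, D (padicValNat 2 (t + 1) + 1)) := by
  classical
  intro ℓ hℓ
  have : Nonempty K := ‹Nonempty ι›.map emb
  rw [movementRegret, sub_le_iff_le_add', ← sub_le_iff_le_add]
  refine le_ciInf fun y => ?_
  -- The comparator `y` is replaced by a nearby leaf, at Lipschitz cost `ρ` per round.
  obtain ⟨i, hi⟩ := hρ y
  rw [sub_le_iff_le_add]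
  set L : ℕ → K → ℝ := fun t => if h : t < T then ℓ ⟨t, h⟩ else fun _ => 0 with hL
  have hLℓ : (fun t : Fin T => L t) = ℓ := by
    funext t
    simp [hL]
  have hL01 : ∀ t i, L t i ∈ Set.Icc (0 : ℝ) 1 := by
    intro t i
    simp only [hL]
    split_ifs with h
    · exact (hℓ _).2 i
    · simp
  have hlaw : (A.strategy η emb).actionLaw ℓ = (A.law η emb L T).map Prod.snd := by
    rw [← hLℓ]; rfl
  have hloss : ∑ t ∈ Finset.range T, L t (emb i) * 1 ≤ ∑ t, ℓ t y + T * ρ := by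
    rw [← Fin.sum_univ_eq_sum_range fun t => L t (emb i) * 1]
    calc ∑ t : Fin T, L t (emb i) * 1 ≤ ∑ t : Fin T, (ℓ t y + ρ) := by
          refine Finset.sum_le_sum fun t _ => ?_
          have e : L t = ℓ t := congrFun hLℓ t
          have h1 := (hℓ t).1.dist_le_mul (emb i) y
          rw [NNReal.coe_one, one_mul, Real.dist_eq] at h1
          rw [e]
          linarith [le_abs_self (ℓ t (emb i) - ℓ t y)]
      _ = _ := by simp [Finset.sum_add_distrib]
  have hcost0 : ∀ x : Fin T → K, 0 ≤ totalCost ℓ x := fun x =>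
    add_nonneg (Finset.sum_nonneg fun t _ => ((hℓ t).2 _).1)
      (Finset.sum_nonneg fun t _ => by split_ifs <;> positivity)
  have hinv : ∀ t ∈ Finset.range T, ∀ h c, ExpectLE (A.law η emb L T)
      (fun z => A.invMass η t h c z.1.2.1 z.1.2.2) 1 := fun t ht h c =>
    ⟨zero_le_one, by simpa using A.expect_invMass_le_one η emb L (Finset.mem_range.1 ht).le h c⟩
  have hmain := (((ExpectLE.sum (Finset.range T) fun t ht =>
      (hinv t ht 0 (A.cell 0 i)).const_mul (hL01 t (emb i)).1).add
    (expectLE_const _ (show 0 ≤ Real.log (Fintype.card ι) / η from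
      div_nonneg (Real.log_natCast_nonneg _) hη.le))).add
    ((ExpectLE.sum (Finset.range T) fun t ht => ExpectLE.sum (Finset.range A.depth) fun j _ =>
      (ExpectLE.sum (Finset.univ.image (A.cell j)) fun c _ => hinv t ht j c).const_mul
        (show (0 : ℝ) ≤ 2 ^ j by positivity)).const_mul (show 0 ≤ η / 2 by positivity))).add
    (expectLE_const _ (show 0 ≤ ∑ t ∈ Finset.range T, D (padicValNat 2 (t + 1) + 1) from
      Finset.sum_nonneg fun t _ => dist_nonneg.trans (hD _ i i rfl)))
  have hcost := (hmain.mono (g := fun z => totalCost ℓ z.2) fun z hz => by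
    have := A.totalCost_le emb hη hD hL01 (A.isHistory_of_mem_support η emb L T z hz) i
    rwa [hLℓ] at this).map (g := Prod.snd)
  rw [← hlaw] at hcost
  refine (hcost.tsum_le hcost0).trans ?_
  simp only [Finset.sum_const, nsmul_eq_mul, Finset.card_range, mul_one] at hloss ⊢
  have e : ∀ j, ((Finset.univ.image (A.cell j)).card : ℝ) = A.numCells j := fun _ => rfl
  simp only [e]
  linarith

end CellTree

lemma sum_indicator_dvd_le (n T : ℕ) :
    (∑ t ∈ Finset.range T, if n ∣ t + 1 then (1 : ℝ) else 0) ≤ T / n := by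
  rw [Finset.sum_ite, Finset.sum_const_zero, add_zero, Finset.sum_const, nsmul_eq_mul, mul_one]
  have : (Finset.range T |>.filter fun t => n ∣ t + 1).card = T / n := by
    exact Nat.card_multiples T n
  rw [this]
  exact Nat.cast_div_le

/-- A cost that depends on the `2`-adic valuation of the round, and that is at most `b` for large
valuations. -/
lemma sum_padicValNat_le {D : ℕ → ℝ} (hD : ∀ h, 0 ≤ D h) {b : ℝ} (H : ℕ) (hb : ∀ h, H ≤ h → D h ≤ b)
    (T : ℕ) : ∑ t ∈ Finset.range T, D (padicValNat 2 (t + 1)) ≤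
      ∑ h ∈ Finset.range H, T / 2 ^ h * D h + T / 2 ^ H * b := by
  have hb0 : 0 ≤ b := (hD H).trans (hb H le_rfl)
  have hc := fun h => sum_indicator_dvd_le (2 ^ h) T
  have pt : ∀ t ∈ Finset.range T, D (padicValNat 2 (t + 1)) ≤
      ∑ h ∈ Finset.range H, (if 2 ^ h ∣ t + 1 then (1 : ℝ) else 0) * D h +
        (if 2 ^ H ∣ t + 1 then (1 : ℝ) else 0) * b := by
    intro t _
    have hd : ∀ h, 2 ^ h ∣ t + 1 ↔ h ≤ padicValNat 2 (t + 1) := fun h =>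
      padicValNat_dvd_iff_le (by omega)
    have h0 : ∀ h ∈ Finset.range H, 0 ≤ (if 2 ^ h ∣ t + 1 then (1 : ℝ) else 0) * D h :=
      fun h _ => mul_nonneg (by split_ifs <;> norm_num) (hD h)
    rcases lt_or_ge (padicValNat 2 (t + 1)) H with h | h
    · have := Finset.single_le_sum h0 (Finset.mem_range.2 h)
      rw [if_pos ((hd _).2 le_rfl), one_mul] at this
      exact this.trans (le_add_of_nonneg_right (mul_nonneg (by split_ifs <;> norm_num) hb0))
    · rw [if_pos ((hd H).2 h), one_mul]
      exact (hb _ h).trans (le_add_of_nonneg_left (Finset.sum_nonneg h0))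
  refine (Finset.sum_le_sum pt).trans ?_
  rw [Finset.sum_add_distrib, Finset.sum_comm]
  simp only [← Finset.sum_mul]
  gcongr with h
  · exact hD h
  · exact_mod_cast hc h
  · exact_mod_cast hc H

end MovementBandit

namespace MovementBandit

universe u
variable {K : Type u} [MetricSpace K]

/-! ### Trees of cells from minimal covers -/

/-- The cell of level `h` of a point, when `c h` sends each point to a centre of level `h`. -/
def centre (c : ℕ → K → K) : ℕ → K → K
  | 0, x => x
  | h + 1, x => c (h + 1) (centre c h x)

lemma dist_centre_le {c : ℕ → K → K} {ε : ℕ → ℝ≥0} (hc : ∀ h x, dist x (c h x) ≤ ε h) (h : ℕ)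
    (x : K) : dist x (centre c h x) ≤ ∑ j ∈ Finset.range h, (ε (j + 1) : ℝ) := by
  induction h with
  | zero => simp [centre]
  | succ h ih =>
    rw [Finset.sum_range_succ]
    exact (dist_triangle _ (centre c h x) _).trans (add_le_add ih (hc _ _))

/-- Minimal covers at a sequence of scales give a tree of cells. -/
theorem exists_cellTree [Nonempty K] (hdiam : ∀ x y : K, dist x y ≤ 1) {ε : ℕ → ℝ≥0}
    (hfin : ∀ h, coveringNum K (ε h) ≠ ⊤) {H : ℕ} (hH : ∀ h, H ≤ h → 1 ≤ ε h) :
    ∃ (ι : Type u) (_ : Fintype ι) (_ : Nonempty ι) (A : CellTree ι K) (emb : ι → K),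
      A.depth = H ∧ (∀ y, ∃ i, dist (emb i) y ≤ ε 0) ∧
      (∀ h i j, A.cell h i = A.cell h j →
        dist (emb i) (emb j) ≤ 2 * ∑ j ∈ Finset.range h, (ε (j + 1) : ℝ)) ∧
      (∀ h, A.numCells h ≤ (coveringNum K (ε h)).toNat) ∧
      Fintype.card ι ≤ (coveringNum K (ε 0)).toNat := by
  classical
  choose C _ hCfin hCcov hCcard using fun h =>
    Metric.exists_set_encard_eq_coveringNumber (hfin h)
  have hex : ∀ h x, ∃ y ∈ C h, dist x y ≤ ε h := by
    intro h x
    obtain ⟨y, hy, hxy⟩ := hCcov h (Set.mem_univ x)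
    refine ⟨y, hy, ?_⟩
    have : edist x y ≤ ε h := hxy
    rwa [edist_nndist, ENNReal.coe_le_coe] at this
  choose c hcmem hcdist using hex
  have hmem : ∀ h, ∀ i ∈ C 0, centre c h i ∈ C h := by
    intro h i hi
    cases h with
    | zero => exact hi
    | succ h => exact hcmem _ _
  have hcard : ∀ h, (hCfin h).toFinset.card = (coveringNum K (ε h)).toNat := by
    intro h
    rw [coveringNum, ← hCcard, (hCfin h).encard_eq_coe_toFinset_card, ENat.toNat_natCast]
  -- At scale at least the diameter one ball suffices, so a minimal cover is a single point and all
  -- leaves share a cell.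
  have hsub : ∀ h, H ≤ h → (C h).Subsingleton := by
    intro h hh
    rw [← Set.encard_le_one_iff_subsingleton, hCcard]
    apply Metric.coveringNumber_le_one_of_ediam_le
    refine Metric.ediam_le fun x _ y _ => ?_
    rw [edist_nndist, ENNReal.coe_le_coe]
    exact (show nndist x y ≤ 1 from hdiam x y).trans (hH h hh)
  have : Fintype (C 0) := (hCfin 0).fintype
  obtain ⟨x₀⟩ := ‹Nonempty K›
  have hne : Nonempty (C 0) := ⟨⟨c 0 x₀, hcmem 0 x₀⟩⟩
  let A : CellTree (C 0) K :=
    { cell := fun h i => centre c h i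
      depth := H
      cell_zero_injective := Subtype.val_injective
      cell_succ := fun h i j e => congrArg (c (h + 1)) e
      cell_top := fun h hh i j => hsub h hh (hmem h i i.2) (hmem h j j.2) }
  refine ⟨C 0, inferInstance, hne, A, Subtype.val, rfl, fun y => ?_, fun h i j e => ?_,
    fun h => ?_, ?_⟩
  · exact ⟨⟨c 0 y, hcmem 0 y⟩, by rw [dist_comm]; exact hcdist 0 y⟩
  · have e' : centre c h i = centre c h j := e
    have h1 := dist_centre_le hcdist h (i : K)
    have h2 := dist_centre_le hcdist h (j : K)
    have h3 := dist_triangle_right (i : K) j (centre c h i)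
    rw [← e'] at h2
    linarith
  · rw [← hcard]
    refine Finset.card_le_card fun y hy => ?_
    obtain ⟨i, -, rfl⟩ := Finset.mem_image.1 hy
    exact (hCfin h).mem_toFinset.2 (hmem h i i.2)
  · rw [← hcard, ← Set.toFinset_card]
    exact Finset.card_le_card fun y hy => by simpa using hy

/-! ### Covering numbers and the upper Minkowski dimension -/

section Dimension

/-- For the empty space `log 0 = ⊥` forces the dimension to be `⊥`, which is not real. -/
lemma nonempty_of_upperMinkowskiDim {d : ℝ} (hdim : upperMinkowskiDim K = d) : Nonempty K := by
  by_contra hK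
  rw [not_nonempty_iff] at hK
  have : upperMinkowskiDim K = ⊥ := by
    rw [upperMinkowskiDim]
    refine (limsup_congr (v := fun _ => ⊥) ?_).trans (limsup_const _)
    filter_upwards [Ioo_mem_nhdsGT (zero_lt_one' ℝ≥0)] with ε hε
    have h0 : coveringNum K ε = 0 := by
      rw [coveringNum, Metric.coveringNumber_eq_zero]
      exact Set.eq_empty_of_isEmpty _
    have hlog : 0 < Real.log (1 / (ε : ℝ)) :=
      Real.log_pos ((one_lt_div (by exact_mod_cast hε.1)).2 (by exact_mod_cast hε.2))
    rw [h0]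
    simp only [ENat.toENNReal_zero, ENNReal.log_zero]
    exact EReal.bot_div_of_pos_ne_top (by exact_mod_cast hlog) (EReal.coe_ne_top _)
  rw [this] at hdim
  exact EReal.coe_ne_bot d hdim.symm

lemma eventually_coveringNum_le {d δ : ℝ} (hdim : upperMinkowskiDim K = d) (hδ : 0 < δ) :
    ∀ᶠ ε : ℝ≥0 in 𝓝[>] 0, ((coveringNum K ε : ℕ∞) : ℝ≥0∞) ≤
      ENNReal.ofReal ((1 / (ε : ℝ)) ^ (d + δ)) := by
  have h1 : upperMinkowskiDim K < ((d + δ : ℝ) : EReal) := by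
    rw [hdim]
    exact_mod_cast lt_add_of_pos_right d hδ
  filter_upwards [eventually_lt_of_limsup_lt h1, Ioo_mem_nhdsGT (zero_lt_one' ℝ≥0)] with ε h2 hε
  have hε0 : (0 : ℝ) < ε := by exact_mod_cast hε.1
  have hlog : 0 < Real.log (1 / (ε : ℝ)) :=
    Real.log_pos ((one_lt_div hε0).2 (by exact_mod_cast hε.2))
  rw [EReal.div_lt_iff (by exact_mod_cast hlog) (EReal.coe_ne_top _), ← EReal.coe_mul] at h2
  rw [← ENNReal.exp_log ((coveringNum K ε : ℕ∞) : ℝ≥0∞)]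
  refine (EReal.exp_monotone h2.le).trans_eq ?_
  rw [EReal.exp_coe, Real.rpow_def_of_pos (by positivity), mul_comm]

/-- Finite dimension gives finite covers at arbitrarily small scales, and covering numbers decrease
in the scale. -/
lemma coveringNum_ne_top {d : ℝ} (hdim : upperMinkowskiDim K = d) {ε : ℝ≥0} (hε : 0 < ε) :
    coveringNum K ε ≠ ⊤ := by
  obtain ⟨ε', h1, h2⟩ :=
    ((eventually_coveringNum_le hdim one_pos).and (Ioo_mem_nhdsGT hε)).exists
  have h3 : coveringNum K ε' ≠ ⊤ := by
    intro h
    rw [h] at h1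
    simp at h1
  exact ne_top_of_le_ne_top h3 (Metric.coveringNumber_anti h2.2.le)

/-- An eventual bound for the covering numbers holds for all scales up to an additive constant. -/
lemma exists_toNat_coveringNum_le (hfin : ∀ ε : ℝ≥0, 0 < ε → coveringNum K ε ≠ ⊤)
    {g : ℝ≥0 → ℝ} (hg : ∀ᶠ ε : ℝ≥0 in 𝓝[>] 0,
      ((coveringNum K ε : ℕ∞) : ℝ≥0∞) ≤ ENNReal.ofReal (g ε)) :
    ∃ C : ℝ, 1 ≤ C ∧ ∀ ε : ℝ≥0, 0 < ε → ((coveringNum K ε).toNat : ℝ) ≤ max (g ε) 0 + C := by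
  obtain ⟨ε₀, h0, hε₀⟩ := (mem_nhdsGT_iff_exists_Ioo_subset' (zero_lt_one' ℝ≥0)).1 hg
  refine ⟨1 + (coveringNum K ε₀).toNat, by simp, fun ε hε => ?_⟩
  rcases lt_or_ge ε ε₀ with h | h
  · have h1 := hε₀ ⟨hε, h⟩
    simp only [Set.mem_ofPred_eq] at h1
    rw [← ENat.natCast_toNat (hfin ε hε), ENat.toENNReal_coe] at h1
    have h2 := ENNReal.toReal_mono ENNReal.ofReal_ne_top h1
    rw [ENNReal.toReal_natCast, ENNReal.toReal_ofReal'] at h2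
    have : (0 : ℝ) ≤ (coveringNum K ε₀).toNat := Nat.cast_nonneg _
    linarith
  · have h1 : (coveringNum K ε).toNat ≤ (coveringNum K ε₀).toNat :=
      ENat.toNat_le_toNat (Metric.coveringNumber_anti h) (hfin ε₀ h0)
    have h2 : ((coveringNum K ε).toNat : ℝ) ≤ (coveringNum K ε₀).toNat := by exact_mod_cast h1
    have := le_max_right (g ε) 0
    linarith

end Dimension

end MovementBandit

namespace MovementBandit

universe u
variable {K : Type u} [MetricSpace K]

/-! ### Choice of scales and the final rates -/

/-- Scales that grow like `2 ^ (h / d)`, from `T ^ (-1 / (d + 2))` up to `1`. -/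
lemma exists_scales {d : ℝ} (hd : 1 ≤ d) {T : ℕ} (hT : 1 ≤ T) :
    ∃ (ε : ℕ → ℝ≥0) (H : ℕ), (∀ h, 0 < ε h) ∧ Monotone ε ∧
      (ε 0 : ℝ) = (T : ℝ) ^ (-(1 / (d + 2))) ∧ (∀ h, H ≤ h → 1 ≤ ε h) ∧ (∀ h < H, ε h ≤ 1) ∧
      (∀ h, (ε h : ℝ) ≤ (T : ℝ) ^ (-(1 / (d + 2))) * 2 ^ h) ∧
      (∀ h, (ε h : ℝ) ^ (-d) = (T : ℝ) ^ (d / (d + 2)) * (2 ^ h)⁻¹) ∧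
      (T : ℝ) ^ (d / (d + 2)) ≤ 2 ^ H ∧ (H : ℝ) ≤ 2 * (1 + Real.log T) := by
  have hT1 : (1 : ℝ) ≤ T := by exact_mod_cast hT
  have hT0 : (0 : ℝ) < T := by linarith
  have hd2 : 0 < d + 2 := by linarith
  have hd0 : 0 < d := by linarith
  set e₀ : ℝ := (T : ℝ) ^ (-(1 / (d + 2))) with he₀
  have he₀pos : 0 < e₀ := Real.rpow_pos_of_pos hT0 _
  have he₀1 : e₀ ≤ 1 := Real.rpow_le_one_of_one_le_of_nonpos hT1 (by
    rw [neg_nonpos]; positivity)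
  set X : ℝ := (T : ℝ) ^ (d / (d + 2)) with hX
  have hXpos : 0 < X := Real.rpow_pos_of_pos hT0 _
  have hXT : X ≤ T := by
    conv_rhs => rw [← Real.rpow_one (T : ℝ)]
    exact Real.rpow_le_rpow_of_exponent_le hT1 ((div_le_one hd2).2 (by linarith))
  have heX : e₀ ^ (-d) = X := by
    rw [he₀, hX, ← Real.rpow_mul hT0.le]
    congr 1
    field_simp
  have hXe : X ^ (1 / d) * e₀ = 1 := by
    rw [← heX, ← Real.rpow_mul he₀pos.le, show -d * (1 / d) = -1 by field_simp,
      Real.rpow_neg_one, inv_mul_cancel₀ he₀pos.ne']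
  let ε : ℕ → ℝ≥0 := fun h => ⟨e₀ * 2 ^ ((h : ℝ) / d), by positivity⟩
  have hεv : ∀ h, (ε h : ℝ) = e₀ * 2 ^ ((h : ℝ) / d) := fun h => rfl
  have hεpos : ∀ h, 0 < ε h := fun h => by
    rw [← NNReal.coe_pos, hεv]; positivity
  have hεmono : Monotone ε := fun h h' hh => by
    rw [← NNReal.coe_le_coe, hεv, hεv]
    gcongr
    norm_num
  have hε0 : (ε 0 : ℝ) = e₀ := by rw [hεv]; simp
  have hpow : ∀ h : ℕ, (2 : ℝ) ^ ((h : ℝ) / d) = ((2 : ℝ) ^ h) ^ (1 / d) := fun h => by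
    rw [← Real.rpow_natCast, ← Real.rpow_mul (by norm_num)]
    congr 1
    ring
  -- The least `H` with `X ≤ 2 ^ H`; since `X ^ (1 / d) * e₀ = 1`, this is where the scales reach
  -- `1`.
  set H := Nat.clog 2 ⌈X⌉₊ with hH
  have hXH : X ≤ 2 ^ H := by
    have h1 : ⌈X⌉₊ ≤ 2 ^ H := Nat.le_pow_clog (by norm_num) _
    exact (Nat.le_ceil X).trans (by exact_mod_cast h1)
  have hHX : ∀ h < H, (2 : ℝ) ^ h ≤ X := by
    intro h hh
    have h1 : 2 ^ h < ⌈X⌉₊ := (Nat.lt_clog_iff_pow_lt (by norm_num)).1 hh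
    have := Nat.lt_ceil.1 h1
    push_cast at this
    exact this.le
  have hεH : ∀ h, H ≤ h → 1 ≤ ε h := by
    intro h hh
    refine le_trans ?_ (hεmono hh)
    rw [← NNReal.coe_le_coe, hεv, hpow, NNReal.coe_one, mul_comm]
    exact hXe.symm.trans_le (by gcongr)
  have hεlt : ∀ h < H, ε h ≤ 1 := by
    intro h hh
    rw [← NNReal.coe_le_coe, hεv, hpow, NNReal.coe_one, mul_comm]
    exact le_of_le_of_eq (by have := hHX h hh; gcongr) hXe
  have hεsucc : ∀ h : ℕ, (ε h : ℝ) ≤ e₀ * 2 ^ h := by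
    intro h
    rw [hεv, ← Real.rpow_natCast]
    gcongr
    · norm_num
    · exact div_le_self (Nat.cast_nonneg _) hd
  set Lg : ℝ := 1 + Real.log T with hLg
  have hLg1 : 1 ≤ Lg := by
    have := Real.log_nonneg hT1
    linarith
  have hHL : (H : ℝ) ≤ 2 * Lg := by
    rcases Nat.eq_zero_or_pos H with h0 | h0
    · rw [h0]; push_cast; linarith
    · have h1 := (hHX (H - 1) (by omega)).trans hXT
      have h2 := Real.log_le_log (by positivity) h1
      rw [Real.log_pow, Nat.cast_sub h0, Nat.cast_one] at h2
      have h3 := Real.log_two_gt_d9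
      have h4 : (0 : ℝ) ≤ H - 1 := by
        have : (1 : ℝ) ≤ H := by exact_mod_cast h0
        linarith
      nlinarith
  refine ⟨ε, H, hεpos, hεmono, hε0, hεH, hεlt, hεsucc, fun h => ?_, hXH, hHL⟩
  rw [hεv, Real.mul_rpow he₀pos.le (by positivity), heX, hpow,
    ← Real.rpow_mul (by positivity), show 1 / d * -d = -1 by field_simp, Real.rpow_neg_one]

/-- The strategy of the tree with scales `T ^ (-1 / (d + 2)) * 2 ^ (h / d)`: covering numbers of
order `ε ^ (-d)` give regret of order `T ^ ((d + 1) / (d + 2))`. -/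
theorem exists_strategy (hdiam : ∀ x y : K, dist x y ≤ 1) [Nonempty K]
    (hfin : ∀ ε : ℝ≥0, 0 < ε → coveringNum K ε ≠ ⊤) {d : ℝ} (hd : 1 ≤ d) {T : ℕ} (hT : 1 ≤ T) :
    ∃ S : Strategy K, ∀ M : ℝ, 1 ≤ M →
      (∀ ε : ℝ≥0, (T : ℝ) ^ (-(1 / (d + 2))) ≤ ε → ε ≤ 1 →
        ((coveringNum K ε).toNat : ℝ) ≤ M * (ε : ℝ) ^ (-d)) →
      Guarantees S T (21 * M * (1 + Real.log T) ^ 2 * (T : ℝ) ^ ((d + 1) / (d + 2))) := by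
  have hT1 : (1 : ℝ) ≤ T := by exact_mod_cast hT
  have hT0 : (0 : ℝ) < T := by linarith
  have hd2 : 0 < d + 2 := by linarith
  have hd0 : 0 < d := by linarith
  set e₀ : ℝ := (T : ℝ) ^ (-(1 / (d + 2))) with he₀
  have he₀pos : 0 < e₀ := Real.rpow_pos_of_pos hT0 _
  have he₀1 : e₀ ≤ 1 := Real.rpow_le_one_of_one_le_of_nonpos hT1 (by
    rw [neg_nonpos]; positivity)
  set X : ℝ := (T : ℝ) ^ (d / (d + 2)) with hX
  have hXpos : 0 < X := Real.rpow_pos_of_pos hT0 _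
  have hXT : X ≤ T := by
    conv_rhs => rw [← Real.rpow_one (T : ℝ)]
    exact Real.rpow_le_rpow_of_exponent_le hT1 ((div_le_one hd2).2 (by linarith))
  set R : ℝ := (T : ℝ) ^ ((d + 1) / (d + 2)) with hR
  have hRpos : 0 < R := Real.rpow_pos_of_pos hT0 _
  have hTe : T * e₀ = R := by
    rw [he₀, hR, ← Real.rpow_one_add' hT0.le (by
      rw [← sub_eq_add_neg, one_sub_div hd2.ne']
      exact (div_pos (by linarith) hd2).ne')]
    congr 1
    field_simp
    ring
  have heX : e₀ ^ (-d) = X := by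
    rw [he₀, hX, ← Real.rpow_mul hT0.le]
    congr 1
    field_simp
  -- The exponent `2 / (d + 2)` is at most `(d + 1) / (d + 2)` because `d ≥ 1`.
  have hTX : T / X ≤ R := by
    rw [hX, hR, ← Real.rpow_one_sub' hT0.le (by
      rw [one_sub_div hd2.ne']; exact (div_pos (by linarith) hd2).ne')]
    apply Real.rpow_le_rpow_of_exponent_le hT1
    rw [one_sub_div hd2.ne']
    gcongr
    linarith
  have hRX : R⁻¹ * T * X = R := by
    rw [hX, hR, ← Real.rpow_neg hT0.le, ← Real.rpow_add_one hT0.ne', ← Real.rpow_add hT0]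
    congr 1
    field_simp
    ring
  set Lg : ℝ := 1 + Real.log T with hLg
  have hLg1 : 1 ≤ Lg := by
    have := Real.log_nonneg hT1
    linarith
  obtain ⟨ε, H, hεpos, hεmono, hε0, hεH, hεlt, hεsucc, hεd, hXH, hHL⟩ := exists_scales hd hT
  obtain ⟨ι, _, _, A, emb, hdepth, hnet, hdist, hcells, hcard⟩ :=
    exists_cellTree hdiam (fun h => hfin _ (hεpos h)) hεH
  -- The rate `η = R⁻¹` and the tree do not depend on `M`, so one strategy serves both covering
  -- hypotheses.
  refine ⟨A.strategy R⁻¹ emb, fun M hM hN => ?_⟩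
  have hM0 : 0 < M := by linarith
  -- Capping at the diameter bounds the moves of valuation at least `H`, which cost `T / 2 ^ H ≤ T /
  -- X` in total.
  set D : ℕ → ℝ := fun h => min 1 (2 * ∑ j ∈ Finset.range h, (ε (j + 1) : ℝ)) with hD
  have hD0 : ∀ h, 0 ≤ D h := fun h => le_min zero_le_one (by positivity)
  have hDle : ∀ h, D h ≤ 2 * h * (e₀ * 2 ^ h) := by
    intro h
    refine (min_le_right _ _).trans ?_
    rw [mul_assoc]
    gcongr
    calc ∑ j ∈ Finset.range h, (ε (j + 1) : ℝ) ≤ ∑ j ∈ Finset.range h, (e₀ * 2 ^ h) := by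
          refine Finset.sum_le_sum fun j hj => ?_
          exact (NNReal.coe_le_coe.2 (hεmono (Finset.mem_range.1 hj))).trans (hεsucc h)
      _ = _ := by simp
  have hreg := A.guarantees_strategy emb (inv_pos.2 hRpos) (D := D)
    (fun h i j e => le_min (hdiam _ _) (hdist h i j e)) hnet T
  have hmove : ∑ t ∈ Finset.range T, D (padicValNat 2 (t + 1) + 1) ≤ (16 * Lg ^ 2 + 1) * R := by
    refine (sum_padicValNat_le (D := fun h => D (h + 1)) (fun h => hD0 _) H
      (fun h _ => min_le_left _ _) T).trans ?_
    rw [add_mul, one_mul, mul_one]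
    refine add_le_add ?_ (le_trans ?_ hTX)
    · calc ∑ h ∈ Finset.range H, T / 2 ^ h * D (h + 1)
          ≤ ∑ h ∈ Finset.range H, 4 * H * R := by
            refine Finset.sum_le_sum fun h hh => ?_
            have h1 : ((h + 1 : ℕ) : ℝ) ≤ H := by exact_mod_cast Finset.mem_range.1 hh
            calc T / 2 ^ h * D (h + 1) ≤
                T / 2 ^ h * (2 * ((h + 1 : ℕ) : ℝ) * (e₀ * 2 ^ (h + 1))) := by
                  gcongr; exact hDle _
              _ = 4 * ((h + 1 : ℕ) : ℝ) * R := by rw [← hTe, pow_succ]; field_simp; ring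
              _ ≤ 4 * H * R := by gcongr
        _ = 4 * (H : ℝ) ^ 2 * R := by simp; ring
        _ ≤ 4 * (2 * Lg) ^ 2 * R := by gcongr
        _ = _ := by ring
    · gcongr
  have hlog : Real.log (Fintype.card ι) / R⁻¹ ≤ (M + Lg) * R := by
    rw [div_inv_eq_mul]
    gcongr
    have h1 : (Fintype.card ι : ℝ) ≤ M * X := by
      have h2 := hN (ε 0) hε0.ge (by rw [← NNReal.coe_le_coe, hε0]; exact he₀1)
      rw [hε0, heX] at h2
      exact le_trans (by exact_mod_cast hcard) h2
    have h0 : (0 : ℝ) < Fintype.card ι := by exact_mod_cast Fintype.card_pos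
    have h3 : (Fintype.card ι : ℝ) ≤ M * T := h1.trans (by gcongr)
    have h4 := Real.log_le_log h0 h3
    rw [Real.log_mul hM0.ne' hT0.ne'] at h4
    have := Real.log_le_self hM0.le
    linarith
  have hvar : R⁻¹ / 2 * (T * ∑ j ∈ Finset.range A.depth, 2 ^ j * (A.numCells j : ℝ)) ≤
      Lg * M * R := by
    have h1 : ∀ j ∈ Finset.range H, 2 ^ j * (A.numCells j : ℝ) ≤ M * X := by
      intro j hj
      have hj := Finset.mem_range.1 hj
      have h2 := hN (ε j) (hε0.ge.trans (NNReal.coe_le_coe.2 (hεmono (Nat.zero_le j)))) (hεlt j hj)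
      have h3 : (A.numCells j : ℝ) ≤ M * (ε j : ℝ) ^ (-d) :=
        le_trans (by exact_mod_cast hcells j) h2
      calc 2 ^ j * (A.numCells j : ℝ) ≤ 2 ^ j * (M * (X * (2 ^ j)⁻¹)) := by
            rw [← hεd j]; gcongr
        _ = M * X := by field_simp
    have h5 := Finset.sum_le_sum h1
    rw [Finset.sum_const, nsmul_eq_mul, Finset.card_range] at h5
    rw [hdepth]
    calc R⁻¹ / 2 * (T * ∑ j ∈ Finset.range H, 2 ^ j * (A.numCells j : ℝ))
        ≤ R⁻¹ / 2 * (T * (2 * Lg * (M * X))) := by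
          gcongr
          exact h5.trans (by gcongr)
      _ = Lg * M * (R⁻¹ * T * X) := by ring
      _ = Lg * M * R := by rw [hRX]
  intro ℓ hℓ
  refine (hreg ℓ hℓ).trans ?_
  rw [hε0, hTe]
  -- Net error, entropy, variance and movement, in units of `R`; every term is absorbed into `M * Lg
  -- ^ 2`.
  have hsum : 1 + (M + Lg) + Lg * M + (16 * Lg ^ 2 + 1) ≤ 21 * M * Lg ^ 2 := by
    have h1 : 1 ≤ Lg ^ 2 := one_le_pow₀ hLg1
    have h2 : Lg ≤ Lg ^ 2 := le_self_pow₀ hLg1 (by norm_num)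
    have h3 : Lg ^ 2 ≤ M * Lg ^ 2 := le_mul_of_one_le_left (by positivity) hM
    have h4 : M ≤ M * Lg ^ 2 := le_mul_of_one_le_right hM0.le h1
    have h5 : Lg * M ≤ M * Lg ^ 2 := by rw [mul_comm]; gcongr
    linarith
  have := mul_le_mul_of_nonneg_right hsum hRpos.le
  linarith

end MovementBandit

theorem theorem3 {K : Type*} [MetricSpace K] (hdiam : ∀ x y : K, dist x y ≤ 1)
    (d : ℝ) (hd : 1 ≤ d) (hdim : MovementBandit.upperMinkowskiDim K = (d : EReal)) :
    ∃ S : ℕ → MovementBandit.Strategy K,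
      (∀ δ : ℝ, 0 < δ → ∃ C : ℝ, ∀ T : ℕ, 1 ≤ T →
        MovementBandit.Guarantees (S T) T (C * (T : ℝ) ^ ((d + 1) / (d + 2) + δ))) ∧
      (MovementBandit.CoveringNumIsPolylog K d → ∃ (p : ℕ) (C : ℝ), ∀ T : ℕ, 1 ≤ T →
        MovementBandit.Guarantees (S T) T
          (C * (1 + Real.log T) ^ p * (T : ℝ) ^ ((d + 1) / (d + 2)))) := by
  have := MovementBandit.nonempty_of_upperMinkowskiDim hdim
  have hfin := fun (ε : ℝ≥0) (hε : 0 < ε) => MovementBandit.coveringNum_ne_top hdim hε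
  have hex : ∀ T : ℕ, ∃ S : MovementBandit.Strategy K, 1 ≤ T → ∀ M : ℝ, 1 ≤ M →
      (∀ ε : ℝ≥0, (T : ℝ) ^ (-(1 / (d + 2))) ≤ ε → ε ≤ 1 →
        ((MovementBandit.coveringNum K ε).toNat : ℝ) ≤ M * (ε : ℝ) ^ (-d)) →
      MovementBandit.Guarantees S T (21 * M * (1 + Real.log T) ^ 2 * (T : ℝ) ^ ((d + 1) / (d + 2))) := by
    intro T
    rcases Nat.lt_or_ge T 1 with h | h
    · obtain ⟨S, -⟩ := MovementBandit.exists_strategy hdiam hfin hd le_rfl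
      exact ⟨S, fun h' => absurd h' (by omega)⟩
    · obtain ⟨S, hS⟩ := MovementBandit.exists_strategy hdiam hfin hd h
      exact ⟨S, fun _ => hS⟩
  choose S hS using hex
  have hd2 : 1 ≤ d + 2 := by linarith
  have scale : ∀ T : ℕ, 1 ≤ T → ∀ ε : ℝ≥0, (T : ℝ) ^ (-(1 / (d + 2))) ≤ ε →
      (0 : ℝ) < ε ∧ 1 / (ε : ℝ) ≤ T := by
    intro T hT ε h
    have hT1 : (1 : ℝ) ≤ T := by exact_mod_cast hT
    have hT0 : (0 : ℝ) < T := by linarith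
    have h1 : (T : ℝ) ^ (-1 : ℝ) ≤ (T : ℝ) ^ (-(1 / (d + 2))) :=
      Real.rpow_le_rpow_of_exponent_le hT1 (neg_le_neg ((div_le_one (by linarith)).2 hd2))
    rw [Real.rpow_neg_one] at h1
    have h2 := h1.trans h
    have h0 : (0 : ℝ) < ε := (inv_pos.2 hT0).trans_le h2
    exact ⟨h0, by rw [one_div]; exact inv_le_of_inv_le₀ hT0 h2⟩
  refine ⟨S, fun δ hδ => ?_, fun ⟨q, C₀, hC₀⟩ => ?_⟩
  · obtain ⟨C, hC1, hC⟩ := MovementBandit.exists_toNat_coveringNum_le hfin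
      (MovementBandit.eventually_coveringNum_le hdim (half_pos hδ))
    refine ⟨21 * (1 + C) * (1 + 4 / δ) ^ 2, fun T hT => ?_⟩
    have hT1 : (1 : ℝ) ≤ T := by exact_mod_cast hT
    have hT0 : (0 : ℝ) < T := by linarith
    -- The exponent excess `δ / 2` of the covering numbers costs `T ^ (δ / 2)`, as `1 / ε ≤ T` at
    -- the scales used; the squared logarithm takes the other `δ / 2`.
    have key := hS T hT ((1 + C) * (T : ℝ) ^ (δ / 2)) (by
      have := Real.one_le_rpow hT1 (half_pos hδ).le
      nlinarith) (by
      intro ε hε hε1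
      obtain ⟨h0, h1⟩ := scale T hT ε hε
      have hge : 1 ≤ 1 / (ε : ℝ) := (one_le_div h0).2 (by exact_mod_cast hε1)
      have h2 := hC ε (by exact_mod_cast h0)
      rw [max_eq_left (by positivity)] at h2
      have h3 : 1 ≤ (1 / (ε : ℝ)) ^ (d + δ / 2) := Real.one_le_rpow hge (by linarith)
      have h4 : (1 / (ε : ℝ)) ^ (d + δ / 2) ≤ (T : ℝ) ^ (δ / 2) * (ε : ℝ) ^ (-d) := by
        rw [Real.rpow_add (by positivity), mul_comm, one_div, Real.inv_rpow h0.le d,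
          ← Real.rpow_neg h0.le, ← one_div]
        gcongr
      calc _ ≤ _ := h2
        _ ≤ (1 + C) * (1 / (ε : ℝ)) ^ (d + δ / 2) := by nlinarith
        _ ≤ (1 + C) * ((T : ℝ) ^ (δ / 2) * (ε : ℝ) ^ (-d)) := by gcongr
        _ = _ := by ring)
    intro ℓ hℓ
    refine (key ℓ hℓ).trans ?_
    have hlog : 1 + Real.log T ≤ (1 + 4 / δ) * (T : ℝ) ^ (δ / 4) := by
      have h1 := Real.log_le_rpow_div hT0.le (show 0 < δ / 4 by positivity)
      have h2 := Real.one_le_rpow hT1 (show 0 ≤ δ / 4 by positivity)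
      calc 1 + Real.log T ≤ (T : ℝ) ^ (δ / 4) + (T : ℝ) ^ (δ / 4) / (δ / 4) := add_le_add h2 h1
        _ = _ := by field_simp
    have hlog0 : 0 ≤ 1 + Real.log T := by
      have := Real.log_nonneg hT1
      linarith
    calc 21 * ((1 + C) * (T : ℝ) ^ (δ / 2)) * (1 + Real.log T) ^ 2 * (T : ℝ) ^ ((d + 1) / (d + 2))
        ≤ 21 * ((1 + C) * (T : ℝ) ^ (δ / 2)) * ((1 + 4 / δ) * (T : ℝ) ^ (δ / 4)) ^ 2 *
          (T : ℝ) ^ ((d + 1) / (d + 2)) := by gcongr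
      _ = 21 * (1 + C) * (1 + 4 / δ) ^ 2 * ((T : ℝ) ^ ((d + 1) / (d + 2)) *
          ((T : ℝ) ^ (δ / 4) * (T : ℝ) ^ (δ / 4) * (T : ℝ) ^ (δ / 2))) := by ring
      _ = _ := by
        rw [← Real.rpow_add hT0, ← Real.rpow_add hT0, ← Real.rpow_add hT0]
        congr 3
        ring
  · obtain ⟨C, hC1, hC⟩ := MovementBandit.exists_toNat_coveringNum_le hfin hC₀
    refine ⟨q + 2, 21 * (|C₀| + C), fun T hT => ?_⟩
    have hT1 : (1 : ℝ) ≤ T := by exact_mod_cast hT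
    have hT0 : (0 : ℝ) < T := by linarith
    have hL1 : 1 ≤ 1 + Real.log T := by
      have := Real.log_nonneg hT1
      linarith
    have hLq : 1 ≤ (1 + Real.log T) ^ q := one_le_pow₀ hL1
    have habs := abs_nonneg C₀
    -- Here `log (1 / ε) ≤ 1 + log T`, so `M` is polylogarithmic; `|C₀|` is used because `C₀` may be
    -- negative.
    have key := hS T hT ((|C₀| + C) * (1 + Real.log T) ^ q) (by nlinarith) (by
      intro ε hε hε1
      obtain ⟨h0, h1⟩ := scale T hT ε hε
      have hge : 1 ≤ 1 / (ε : ℝ) := (one_le_div h0).2 (by exact_mod_cast hε1)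
      have h2 := hC ε (by exact_mod_cast h0)
      have hlog0 := Real.log_nonneg hge
      have hlog : Real.log (1 / (ε : ℝ)) ≤ 1 + Real.log T :=
        (Real.log_le_log (by positivity) h1).trans (by linarith)
      have h3 : 1 ≤ (1 / (ε : ℝ)) ^ d := Real.one_le_rpow hge (by linarith)
      have h5 : (1 / (ε : ℝ)) ^ d = (ε : ℝ) ^ (-d) := by
        rw [one_div, Real.inv_rpow h0.le, Real.rpow_neg h0.le]
      have h4 : max (C₀ * Real.log (1 / (ε : ℝ)) ^ q * (1 / (ε : ℝ)) ^ d) 0 ≤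
          |C₀| * (1 + Real.log T) ^ q * (1 / (ε : ℝ)) ^ d := by
        refine max_le ?_ (by positivity)
        gcongr
        exact le_abs_self _
      have h6 : C ≤ C * (1 + Real.log T) ^ q * (1 / (ε : ℝ)) ^ d := by
        rw [mul_assoc]
        exact le_mul_of_one_le_right (by linarith) (one_le_mul_of_one_le_of_one_le hLq h3)
      rw [← h5]
      linarith)
    intro ℓ hℓ
    refine (key ℓ hℓ).trans (le_of_eq ?_)
    ring
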